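/- Let $G=(V,E)$ be a finite undirected loopless multigraph (parallel edges are allowed) with edge weights $w:E\to\mathbb R$, and put $m=|E|$. A set of edges is independent in the graphic matroid of $G$ if it contains no cycle (two parallel edges form a cycle of length two), and $\mathrm{OPT}$ is the maximum total weight of an independent set. In the graphic matroid secretary problem the edges arrive one at a time, in an order chosen uniformly at random among all $m!$ orders. A (randomized) online algorithm knows $V$ and $m$ in advance; when an edge arrives, its endpoints and its weight are revealed, and the algorithm must decide immediately and irrevocably whether to accept it, based only on the edges that have arrived so far and on its own internal randomness, which is independent of the arrival order. The set of accepted edges must always be independent. For $\alpha\ge 1$, an algorithm is called $\alpha$-competitive on a class of weighted graphs if $\alpha\cdot\mathbb E[\text{total weight of the accepted edges}]\ge \mathrm{OPT}$ for every weighted graph in the class. **Theorem 1.** There is a $3.95$-competitive online algorithm for the graphic matroid secretary problem on all finite loopless weighted multigraphs. Furthermore, there is a $3.77$-competitive online algorithm for the graphic matroid secretary problem on finite simple weighted graphs (at most one edge between any two vertices). -/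

import Mathlib

universe u v

namespace GraphicSecretary

/-- Independence in the graphic matroid of the multigraph `G`: the edge set `F` contains no cycle.
A cycle of length `k + 2` (so of length at least two; two parallel edges form a cycle of length two)
consists of distinct vertices `x 0, …, x (k + 1)` and distinct edges `c 0, …, c (k + 1)`, where `c i`
joins `x i` to `x (i + 1)`; the addition in `Fin (k + 2)` is cyclic. -/
def Indep {V : Type u} {E : Type v} (G : Graph V E) (F : Finset E) : Prop :=
  ∀ (k : ℕ) (x : Fin (k + 2) → V) (c : Fin (k + 2) → E),
    Function.Injective x → Function.Injective c →
    (∀ i, G.IsLink (c i) (x i) (x (i + 1))) → ∃ i, c i ∉ F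

theorem indep_empty {V : Type u} {E : Type v} (G : Graph V E) : Indep G ∅ :=
  fun _ _ _ _ _ _ => ⟨0, Finset.notMem_empty _⟩

open scoped Classical in
/-- `OPT`: the maximum weight of an independent set of edges. -/
noncomputable def opt {V : Type u} {E : Type v} [Fintype E] (G : Graph V E) (w : E → ℝ) : ℝ :=
  (Finset.univ.filter fun F : Finset E => Indep G F).sup'
    ⟨∅, Finset.mem_filter.mpr ⟨Finset.mem_univ _, indep_empty G⟩⟩ fun F => ∑ e ∈ F, w e

/-- A randomized online algorithm for `m` edges arriving on the vertex set `V`. It draws a random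
seed from a finite probability space. When the edge of time `t` arrives, it decides irrevocably
whether to accept it, from the seed and from what has been revealed so far: the set of endpoints and
the weight of each edge of the times `s ≤ t`. (Its earlier decisions are determined by these data.) -/
structure OnlineAlgorithm (V : Type u) (m : ℕ) where
  Seed : Type
  [fintypeSeed : Fintype Seed]
  prob : Seed → ℝ
  prob_nonneg : ∀ s, 0 ≤ prob s
  sum_prob : ∑ s, prob s = 1
  accept : Seed → (t : Fin m) → (Set.Iic t → Set V × ℝ) → Bool

attribute [instance] OnlineAlgorithm.fintypeSeed

/-- What is revealed up to and including time `t`, if the edge of time `s` is `σ s`. -/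
def history {V : Type u} {E : Type v} {m : ℕ} (G : Graph V E) (w : E → ℝ) (σ : Fin m ≃ E)
    (t : Fin m) : Set.Iic t → Set V × ℝ :=
  fun s => ({x : V | G.Inc (σ s.1) x}, w (σ s.1))

/-- The set of accepted edges, for the arrival order `σ` and the seed `s`. -/
def accepted {V : Type u} {E : Type v} {m : ℕ} (A : OnlineAlgorithm V m) (G : Graph V E)
    (w : E → ℝ) (σ : Fin m ≃ E) (s : A.Seed) : Finset E :=
  (Finset.univ.filter fun t : Fin m => A.accept s t (history G w σ t) = true).map σ.toEmbedding

open scoped Classical in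
/-- The expected accepted weight, over a uniformly random arrival order and an independent seed. -/
noncomputable def expectedWeight {V : Type u} {E : Type v} [Fintype E] {m : ℕ}
    (A : OnlineAlgorithm V m) (G : Graph V E) (w : E → ℝ) : ℝ :=
  (∑ σ : Fin m ≃ E, ∑ s : A.Seed, A.prob s * ∑ e ∈ accepted A G w σ s, w e) /
    (Fintype.card (Fin m ≃ E) : ℝ)

/-- On the weighted graph `(G, w)` with `m` edges, the algorithm `A` always accepts an independent
set of edges, and `α` times its expected accepted weight is at least `OPT`. -/
def IsCompetitiveOn {V : Type u} {E : Type v} [Fintype E] {m : ℕ} (α : ℝ)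
    (A : OnlineAlgorithm V m) (G : Graph V E) (w : E → ℝ) : Prop :=
  (∀ (σ : Fin m ≃ E) (s : A.Seed), Indep G (accepted A G w σ s)) ∧
    opt G w ≤ α * expectedWeight A G w

end GraphicSecretary

/-!
The algorithm observes the first `m / 2` edges. Afterwards it maintains a set of marked vertices,
which is empty at first. When an edge `g` arrives, it computes the greedy (maximum-weight) forest
of all the edges seen so far, oriented away from the least vertex of each component, so that every
vertex is the head of at most one edge. If `g` lies in this forest and neither of its endpoints is
marked, `g` is accepted and its head is marked. Ties between equal weights are broken by uniformly
random ranks, so that the forest is determined by the set of the edges seen.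

*Independence* (`exists_not_accepts`). An accepted edge has no endpoint that is the head of an
earlier accepted edge. On a cycle of accepted edges all heads would thus be distinct, so every
vertex of the cycle would be a head, among them both endpoints of the edge that came last.

*Competitiveness.* An edge `{u, v}` of the optimal forest lies in the greedy forest when it
arrives, so it is accepted if it arrives after the sample and `u` and `v` are unmarked. Read
backwards in time, the arrival order is a sequence of uniform choices: given the set `S` of the
first `i` edges, the last one of them is uniform in `S`. It has its head in `{u, v}` with
probability at most `2 / i`. This union bound alone gives ratio `4`. It is wasteful because an edge
`x → u` does not mark `u` if `x` is marked, and the gain is the probability that `x` is marked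
while `u` and `v` are not; this is bounded below by the same kind of recursion
(`le_mean_unmarkedMarked`), and fed into the one for the pair (`le_mean_unmarked_pair`). For the
recursion to give a gain also if `x` is not the head of any edge of the current forest, such
vertices are marked at random at a comparable rate, `4 / (5 i)` at time `i`. An edge between `u`
and `v` yields no gain. Before `{u, v}` itself has arrived, each forest contains at most one such
edge, and none if the graph is simple; this is the difference between the two ratios, for which
`pairBound` solves the recursion and `le_mul_sum_pairBound_zero` and `le_mul_sum_pairBound_one` sum
the solution over all times.

`mean` is the expectation defined by the backward recursion, and `sum_state_eq_sum_mean` identifies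
it with the average over all arrival orders. `opt_le_sum_optimalForest` is the optimality of the
greedy forest.
-/

namespace GraphicSecretary

/-! ### Connectivity and forests -/

/-- What an edge is to the algorithm: its set of endpoints, its weight, and a tie-breaking rank. -/
abbrev Rec (V : Type u) := Set V × ℝ × ℕ

/-- `a` and `b` are the endpoints of a member of `T`. -/
def JoinedBy {V : Type u} (T : Set (Rec V)) (a b : V) : Prop := ∃ r ∈ T, r.1 = {a, b}

/-- `a` and `b` lie in the same connected component of the graph with edge set `T`. -/
def Conn {V : Type u} (T : Set (Rec V)) (a b : V) : Prop := Relation.ReflTransGen (JoinedBy T) a b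

theorem JoinedBy.symm {V : Type u} {T : Set (Rec V)} {a b : V} (h : JoinedBy T a b) :
    JoinedBy T b a := by
  obtain ⟨r, hr, e⟩ := h
  exact ⟨r, hr, by rw [e, Set.pair_comm]⟩

theorem Conn.refl {V : Type u} (T : Set (Rec V)) (a : V) : Conn T a a := Relation.ReflTransGen.refl

theorem Conn.trans {V : Type u} {T : Set (Rec V)} {a b c : V} (h : Conn T a b) (h' : Conn T b c) :
    Conn T a c := Relation.ReflTransGen.trans h h'

theorem Conn.symm {V : Type u} {T : Set (Rec V)} {a b : V} (h : Conn T a b) : Conn T b a := by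
  induction h with
  | refl => exact Conn.refl _ _
  | tail _ hbc ih => exact Relation.ReflTransGen.head hbc.symm ih

theorem Conn.mono {V : Type u} {T T' : Set (Rec V)} (hT : T ⊆ T') {a b : V} (h : Conn T a b) :
    Conn T' a b := by
  induction h with
  | refl => exact Conn.refl _ _
  | tail _ hbc ih =>
    obtain ⟨r, hr, e⟩ := hbc
    exact Relation.ReflTransGen.tail ih ⟨r, hT hr, e⟩

theorem Conn.of_mem {V : Type u} {T : Set (Rec V)} {g : Rec V} (hg : g ∈ T) {a b : V}
    (e : g.1 = {a, b}) : Conn T a b :=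
  Relation.ReflTransGen.single ⟨g, hg, e⟩

/-- If the endpoints of every edge of `X` are connected by `T`, then `T` connects whatever `X`
connects. -/
theorem Conn.of_forall {V : Type u} {X T : Set (Rec V)}
    (h : ∀ r ∈ X, ∀ a b, r.1 = {a, b} → Conn T a b) {a b : V} (hab : Conn X a b) : Conn T a b := by
  induction hab with
  | refl => exact Conn.refl _ _
  | tail _ hbc ih =>
    obtain ⟨r, hr, e⟩ := hbc
    exact ih.trans (h r hr _ _ e)

theorem pair_eq_cases {V : Type u} {a b c d : V} (h : ({a, b} : Set V) = {c, d}) :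
    (a = c ∧ b = d) ∨ (a = d ∧ b = c) := Set.pair_eq_pair_iff.mp h

theorem Conn.insert_cases {V : Type u} {T : Set (Rec V)} {g : Rec V} {a b : V}
    (e : g.1 = {a, b}) {y z : V} (h : Conn (insert g T) y z) :
    Conn T y z ∨ (Conn T y a ∧ Conn T b z) ∨ (Conn T y b ∧ Conn T a z) := by
  induction h with
  | refl => exact Or.inl (Conn.refl _ _)
  | @tail c d _ hcd ih =>
    obtain ⟨r, hr, er⟩ := hcd
    rcases hr with rfl | hr
    · rw [e] at er
      rcases pair_eq_cases er with ⟨rfl, rfl⟩ | ⟨rfl, rfl⟩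
      · rcases ih with h | h | h
        · exact Or.inr (Or.inl ⟨h, Conn.refl _ _⟩)
        · exact Or.inr (Or.inl ⟨h.1, Conn.refl _ _⟩)
        · exact Or.inl h.1
      · rcases ih with h | h | h
        · exact Or.inr (Or.inr ⟨h, Conn.refl _ _⟩)
        · exact Or.inl h.1
        · exact Or.inr (Or.inr ⟨h.1, Conn.refl _ _⟩)
    · have hcd : Conn T c d := Conn.of_mem hr er
      rcases ih with h | h | h
      · exact Or.inl (h.trans hcd)
      · exact Or.inr (Or.inl ⟨h.1, h.2.trans hcd⟩)
      · exact Or.inr (Or.inr ⟨h.1, h.2.trans hcd⟩)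

/-- Every edge of `T` is a bridge, so `T` is the edge set of a forest. -/
def IsForest {V : Type u} (T : Set (Rec V)) : Prop :=
  ∀ g ∈ T, ∀ a b, g.1 = {a, b} → ¬ Conn (T \ {g}) a b

theorem isForest_empty {V : Type u} : IsForest (∅ : Set (Rec V)) := fun _ h => h.elim

theorem IsForest.insert_edge {V : Type u} {T : Set (Rec V)} (hT : IsForest T) {g : Rec V} {a b : V}
    (hg : g ∉ T) (e : g.1 = {a, b}) (hab : ¬ Conn T a b) : IsForest (insert g T) := by
  intro r hr c d er hcd
  rcases eq_or_ne r g with rfl | hrg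
  · have : insert r T \ {r} = T := by
      ext x; simp only [Set.mem_sdiff, Set.mem_insert_iff, Set.mem_singleton_iff]
      constructor
      · rintro ⟨h | h, h'⟩
        · exact absurd h h'
        · exact h
      · exact fun h => ⟨Or.inr h, fun h' => hg (h' ▸ h)⟩
    rw [this] at hcd
    rw [e] at er
    rcases pair_eq_cases er with ⟨rfl, rfl⟩ | ⟨rfl, rfl⟩
    · exact hab hcd
    · exact hab hcd.symm
  · have hrT : r ∈ T := hr.resolve_left hrg
    have : insert g T \ {r} = insert g (T \ {r}) :=
      Set.insert_sdiff_of_notMem _ (by simpa using fun h => hrg h.symm)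
    rw [this] at hcd
    have hle : T \ {r} ⊆ T := Set.sdiff_subset
    have hc : Conn T c d := Conn.of_mem hrT er
    rcases Conn.insert_cases e hcd with h | ⟨h1, h2⟩ | ⟨h1, h2⟩
    · exact hT r hrT c d er h
    · exact hab (((h1.mono hle).symm.trans hc).trans (h2.mono hle).symm)
    · exact hab ((h2.mono hle).trans (hc.symm.trans (h1.mono hle)))

/-- An arbitrary enumeration of the vertices; components are compared by their least vertex. -/
noncomputable def vcode {V : Type u} [Fintype V] (x : V) : ℕ := (Fintype.equivFin V x : ℕ)

theorem vcode_injective {V : Type u} [Fintype V] : Function.Injective (vcode (V := V)) :=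
  fun _ _ h => (Fintype.equivFin V).injective (Fin.ext h)

/-- The least vertex of the component of `a` precedes the component of `b`. -/
def Leads {V : Type u} [Fintype V] (T : Set (Rec V)) (a b : V) : Prop :=
  ∃ a', Conn T a a' ∧ ∀ b', Conn T b b' → vcode a' < vcode b'

theorem exists_least {V : Type u} [Fintype V] (T : Set (Rec V)) (a : V) :
    ∃ a', Conn T a a' ∧ ∀ b, Conn T a b → vcode a' ≤ vcode b := by
  have hne : {x | Conn T a x}.Nonempty := ⟨a, Conn.refl _ _⟩
  obtain ⟨a', h1, h2⟩ := Set.exists_min_image {x | Conn T a x} vcode (Set.toFinite _) hne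
  exact ⟨a', h1, h2⟩

theorem leads_or_leads {V : Type u} [Fintype V] {T : Set (Rec V)} {a b : V} (h : ¬ Conn T a b) :
    Leads T a b ∨ Leads T b a := by
  obtain ⟨a', ha, ha'⟩ := exists_least T a
  obtain ⟨b', hb, hb'⟩ := exists_least T b
  rcases lt_trichotomy (vcode a') (vcode b') with hlt | heq | hlt
  · exact Or.inl ⟨a', ha, fun c hc => hlt.trans_le (hb' c hc)⟩
  · have := vcode_injective heq
    subst this
    exact absurd (ha.trans hb.symm) h
  · exact Or.inr ⟨b', hb, fun c hc => hlt.trans_le (ha' c hc)⟩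

theorem Leads.asymm {V : Type u} [Fintype V] {T : Set (Rec V)} {a b : V} (h : Leads T a b) :
    ¬ Leads T b a := by
  obtain ⟨a', ha, ha'⟩ := h
  rintro ⟨b', hb, hb'⟩
  exact absurd (ha' b' hb) (hb' a' ha).not_gt

/-- The orientation of a forest `F` away from the least vertices of its components: `g` runs from
its tail `a` to its head `b`. -/
def Heads {V : Type u} [Fintype V] (F : Set (Rec V)) (g : Rec V) (a b : V) : Prop :=
  g ∈ F ∧ g.1 = {a, b} ∧ Leads (F \ {g}) a b

theorem Heads.ends_eq {V : Type u} [Fintype V] {F : Set (Rec V)} {g : Rec V} {a b a' b' : V}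
    (h : Heads F g a b) (h' : Heads F g a' b') : a = a' ∧ b = b' := by
  have e := h.2.1
  rw [h'.2.1] at e
  rcases pair_eq_cases e with ⟨rfl, rfl⟩ | ⟨rfl, rfl⟩
  · exact ⟨rfl, rfl⟩
  · exact absurd h'.2.2 h.2.2.asymm

theorem IsForest.exists_heads {V : Type u} [Fintype V] {F : Set (Rec V)} (hF : IsForest F)
    {g : Rec V} (hg : g ∈ F) {a b : V} (e : g.1 = {a, b}) : Heads F g a b ∨ Heads F g b a := by
  rcases leads_or_leads (hF g hg a b e) with h | h
  · exact Or.inl ⟨hg, e, h⟩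
  · exact Or.inr ⟨hg, by rw [e, Set.pair_comm], h⟩

/-- Without `g`, the component of the tail of `g` avoids every other edge at the head `b` of `g`, so
it is attached to `b` by `g` alone. -/
theorem IsForest.tail_component {V : Type u} [Fintype V] {F : Set (Rec V)} (hF : IsForest F)
    {g g' : Rec V} {a a' b y : V} (h : Heads F g a b) (h' : Heads F g' a' b) (hne : g ≠ g')
    (hy : Conn (F \ {g}) a y) : Conn (F \ {g'}) b y := by
  have hb : Conn (F \ {g'}) a b := Conn.of_mem (Set.mem_sdiff_of_mem h.1 hne) h.2.1
  refine hb.symm.trans ?_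
  induction hy with
  | refl => exact Conn.refl _ _
  | @tail c d hc hcd ih =>
    refine ih.trans ?_
    obtain ⟨r, hr, er⟩ := hcd
    refine Conn.of_mem (Set.mem_sdiff_of_mem hr.1 ?_) er
    rintro rfl
    have hcd : Conn (F \ {g}) c d := Conn.of_mem hr er
    have e := h'.2.1
    rw [er] at e
    rcases pair_eq_cases e with ⟨_, rfl⟩ | ⟨rfl, _⟩
    · exact hF g h.1 a _ h.2.1 (hc.trans hcd)
    · exact hF g h.1 a _ h.2.1 hc

theorem IsForest.heads_unique {V : Type u} [Fintype V] {F : Set (Rec V)} (hF : IsForest F)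
    {g g' : Rec V} {a a' b : V} (h : Heads F g a b) (h' : Heads F g' a' b) : g = g' := by
  by_contra hne
  obtain ⟨m, hm, hm'⟩ := h.2.2
  obtain ⟨m', hn, hn'⟩ := h'.2.2
  exact absurd (hm' m' (hF.tail_component h' h (Ne.symm hne) hn))
    (hn' m (hF.tail_component h h' hne hm)).not_gt

/-- The vertices that are not the least vertex of their component. Their number is the rank of `T`
in the graphic matroid. -/
def NonLeast {V : Type u} [Fintype V] (T : Set (Rec V)) : Set V :=
  {b | ∃ b', Conn T b b' ∧ vcode b' < vcode b}

theorem ncard_nonLeast_le {V : Type u} [Fintype V] (T : Finset (Rec V)) :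
    (NonLeast (T : Set (Rec V))).ncard ≤ T.card := by
  classical
  induction T using Finset.induction_on with
  | empty =>
    have : NonLeast ((∅ : Finset (Rec V)) : Set (Rec V)) = ∅ := by
      ext b
      simp only [NonLeast, Set.mem_ofPred_eq, Set.mem_empty_iff_false, iff_false]
      rintro ⟨b', h, hlt⟩
      rcases Relation.ReflTransGen.cases_head h with rfl | ⟨c, ⟨r, hr, _⟩, _⟩
      · exact lt_irrefl _ hlt
      · simp at hr
    rw [this]; simp
  | insert g T hg ih =>
    rw [Finset.card_insert_of_notMem hg, Finset.coe_insert]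
    by_cases hp : ∃ a b, g.1 = {a, b}
    · obtain ⟨a, b, e⟩ := hp
      set N := NonLeast (T : Set (Rec V)) with hN
      set N' := NonLeast (insert g (T : Set (Rec V))) with hN'
      -- adding one edge merges at most two components, and only one least vertex is lost
      have key : (N' \ N).ncard ≤ 1 := by
        rw [Set.ncard_le_one (Set.toFinite _)]
        rintro y ⟨⟨y', hy, hylt⟩, hyN⟩ z ⟨⟨z', hz, hzlt⟩, hzN⟩
        have ymin : ∀ c, Conn (T : Set (Rec V)) y c → vcode y ≤ vcode c := fun c hc =>
          not_lt.mp fun h => hyN ⟨c, hc, h⟩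
        have zmin : ∀ c, Conn (T : Set (Rec V)) z c → vcode z ≤ vcode c := fun c hc =>
          not_lt.mp fun h => hzN ⟨c, hc, h⟩
        have same : ∀ c, Conn (T : Set (Rec V)) y c → Conn (T : Set (Rec V)) z c → y = z :=
          fun c h1 h2 => vcode_injective
            (le_antisymm (ymin z (h1.trans h2.symm)) (zmin y (h2.trans h1.symm)))
        rcases Conn.insert_cases e hy with h | ⟨h1, h2⟩ | ⟨h1, h2⟩
        · exact absurd (ymin _ h) hylt.not_ge
        all_goals
          rcases Conn.insert_cases e hz with h' | ⟨h1', h2'⟩ | ⟨h1', h2'⟩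
          · exact absurd (zmin _ h') hzlt.not_ge
        · exact same _ h1 h1'
        · have := zmin y' (h1'.trans h2); have := ymin z' (h1.trans h2'); omega
        · have := zmin y' (h1'.trans h2); have := ymin z' (h1.trans h2'); omega
        · exact same _ h1 h1'
      have hsub : N' ⊆ N ∪ (N' \ N) := fun x hx => by
        by_cases h : x ∈ N
        · exact Or.inl h
        · exact Or.inr ⟨hx, h⟩
      calc N'.ncard ≤ (N ∪ (N' \ N)).ncard := Set.ncard_le_ncard hsub (Set.toFinite _)
        _ ≤ N.ncard + (N' \ N).ncard := Set.ncard_union_le _ _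
        _ ≤ T.card + 1 := Nat.add_le_add ih key
    · have : NonLeast (insert g (T : Set (Rec V))) ⊆ NonLeast (T : Set (Rec V)) := by
        rintro b ⟨b', h, hlt⟩
        refine ⟨b', Conn.of_forall ?_ h, hlt⟩
        rintro r (rfl | hr) c d er
        · exact absurd ⟨c, d, er⟩ hp
        · exact Conn.of_mem hr er
      exact (Set.ncard_le_ncard this (Set.toFinite _)).trans (ih.trans (Nat.le_succ _))

theorem IsForest.card_le {V : Type u} [Fintype V] {T : Finset (Rec V)}
    (hT : IsForest (T : Set (Rec V))) (hp : ∀ r ∈ T, ∃ a b : V, r.1 = {a, b}) :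
    T.card ≤ (NonLeast (T : Set (Rec V))).ncard := by
  classical
  have hex : ∀ r ∈ T, ∃ b, ∃ a, Heads (T : Set (Rec V)) r a b := by
    intro r hr
    obtain ⟨a, b, e⟩ := hp r hr
    rcases hT.exists_heads hr e with h | h
    · exact ⟨b, a, h⟩
    · exact ⟨a, b, h⟩
  rcases T.eq_empty_or_nonempty with rfl | ⟨r₀, hr₀⟩
  · simp
  have : Nonempty V := (hex r₀ hr₀).nonempty
  choose! hd hhd using hex
  have himg : (T.image hd : Set V) ⊆ NonLeast (T : Set (Rec V)) := by
    intro b hb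
    obtain ⟨r, hr, rfl⟩ := Finset.mem_image.mp (Finset.mem_coe.mp hb)
    obtain ⟨a, h⟩ := hhd r hr
    obtain ⟨m, hm, hlt⟩ := h.2.2
    exact ⟨m, (Conn.of_mem h.1 h.2.1).symm.trans (hm.mono Set.sdiff_subset), hlt _ (Conn.refl _ _)⟩
  have hinj : Set.InjOn hd T := by
    intro r hr r' hr' hrr
    obtain ⟨a, h⟩ := hhd r hr
    obtain ⟨a', h'⟩ := hhd r' hr'
    rw [← hrr] at h'
    exact hT.heads_unique h h'
  rw [← Finset.card_image_of_injOn hinj, ← Set.ncard_coe_finset]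
  exact Set.ncard_le_ncard himg (Set.toFinite _)

/-! ### The greedy forest -/

/-- Edges are ranked by decreasing weight; ties are broken by the rank in the record. -/
noncomputable def key {V : Type u} (r : Rec V) : ℝ ×ₗ ℕ := toLex (-r.2.1, r.2.2)

/-- The edges of positive weight that are not spanned by earlier edges of `S`: the maximum-weight
forest of `S`. -/
def greedy {V : Type u} (S : Set (Rec V)) : Set (Rec V) :=
  {g | g ∈ S ∧ 0 < g.2.1 ∧ ∀ a b, g.1 = {a, b} → ¬ Conn {f | f ∈ S ∧ key f < key g} a b}

theorem mem_greedy_of_subset {V : Type u} {S S' : Set (Rec V)} (h : S ⊆ S') {g : Rec V}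
    (hg : g ∈ greedy S') (hS : g ∈ S) : g ∈ greedy S :=
  ⟨hS, hg.2.1, fun a b e hc => hg.2.2 a b e (hc.mono (by exact fun _ hf => ⟨h hf.1, hf.2⟩))⟩

/-- Records of the edges of a loopless graph with distinct tie-breaking ranks. -/
structure Proper {V : Type u} (S : Set (Rec V)) : Prop where
  pair : ∀ r ∈ S, ∃ a b : V, a ≠ b ∧ r.1 = {a, b}
  rank_injOn : Set.InjOn (fun r : Rec V => r.2.2) S

theorem Proper.mono {V : Type u} {S S' : Set (Rec V)} (h : Proper S') (hS : S ⊆ S') : Proper S :=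
  ⟨fun r hr => h.pair r (hS hr), h.rank_injOn.mono hS⟩

theorem Proper.key_lt {V : Type u} {S : Set (Rec V)} (h : Proper S) {f g : Rec V} (hf : f ∈ S)
    (hg : g ∈ S) (hne : f ≠ g) (hle : key f ≤ key g) : key f < key g := by
  refine lt_of_le_of_ne hle fun he => hne (h.rank_injOn hf hg ?_)
  have := congrArg (fun z => (ofLex z).2) he
  simpa [key] using this

theorem isForest_greedy {V : Type u} {S : Finset (Rec V)} (hS : Proper (S : Set (Rec V))) :
    IsForest (greedy (S : Set (Rec V))) := by
  classical
  have main : ∀ s : Finset (Rec V), s ⊆ S →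
      IsForest {g | g ∈ s ∧ g ∈ greedy (S : Set (Rec V))} := by
    intro s
    induction s using Finset.induction_on_max_value (f := key) with
    | empty => intro _; convert isForest_empty (V := V) using 1; ext; simp
    | insert g s hg hmax ih =>
      intro hs
      have hsS : s ⊆ S := fun x hx => hs (Finset.mem_insert_of_mem hx)
      have hgS : g ∈ S := hs (Finset.mem_insert_self _ _)
      by_cases hgr : g ∈ greedy (S : Set (Rec V))
      · obtain ⟨a, b, _, e⟩ := hS.pair g hgS
        have : {x | x ∈ insert g s ∧ x ∈ greedy (S : Set (Rec V))} =
            insert g {x | x ∈ s ∧ x ∈ greedy (S : Set (Rec V))} := by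
          ext x
          simp only [Finset.mem_insert, Set.mem_ofPred_eq, Set.mem_insert_iff]
          constructor
          · rintro ⟨h | h, h'⟩
            · exact Or.inl h
            · exact Or.inr ⟨h, h'⟩
          · rintro (rfl | h)
            · exact ⟨Or.inl rfl, hgr⟩
            · exact ⟨Or.inr h.1, h.2⟩
        rw [this]
        refine (ih hsS).insert_edge (fun h => hg h.1) e fun hc => hgr.2.2 a b e (hc.mono ?_)
        intro f hf
        exact ⟨hsS hf.1, hS.key_lt (hsS hf.1) hgS (fun h => hg (h ▸ hf.1)) (hmax f hf.1)⟩
      · convert ih hsS using 1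
        ext x
        simp only [Finset.mem_insert, Set.mem_ofPred_eq]
        constructor
        · rintro ⟨rfl | h, h'⟩
          · exact absurd h' hgr
          · exact ⟨h, h'⟩
        · exact fun h => ⟨Or.inr h.1, h.2⟩
  have h := main S subset_rfl
  convert h using 1
  ext x
  exact ⟨fun hx => ⟨hx.1, hx⟩, fun hx => hx.2⟩

/-- At each positive weight level, the greedy forest spans all edges. -/
theorem conn_greedy {V : Type u} {S : Finset (Rec V)} {x : ℝ} (hx : 0 < x) {r : Rec V}
    (hr : r ∈ S) (hrx : x ≤ r.2.1) {a b : V} (e : r.1 = {a, b}) :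
    Conn {f | f ∈ greedy (S : Set (Rec V)) ∧ x ≤ f.2.1} a b := by
  classical
  by_contra hcon
  set B := S.filter fun r => x ≤ r.2.1 ∧ ∃ a b : V, r.1 = {a, b} ∧
    ¬ Conn {f | f ∈ greedy (S : Set (Rec V)) ∧ x ≤ f.2.1} a b with hB
  have hne : B.Nonempty := ⟨r, by simp only [hB, Finset.mem_filter]; exact ⟨hr, hrx, a, b, e, hcon⟩⟩
  obtain ⟨g, hg, hmin⟩ := Finset.exists_min_image B key hne
  obtain ⟨hgS, hgx, c, d, eg, hcd⟩ := Finset.mem_filter.mp hg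
  have hgr : g ∉ greedy (S : Set (Rec V)) := fun h => hcd (Conn.of_mem (by exact ⟨h, hgx⟩) eg)
  have : ∃ a b, g.1 = {a, b} ∧ Conn {f | f ∈ (S : Set (Rec V)) ∧ key f < key g} a b := by
    by_contra hno
    push Not at hno
    exact hgr ⟨hgS, hx.trans_le hgx, hno⟩
  obtain ⟨a', b', e', hc⟩ := this
  have hc' : Conn {f | f ∈ greedy (S : Set (Rec V)) ∧ x ≤ f.2.1} a' b' := by
    refine Conn.of_forall (fun f hf y z ef => ?_) hc
    by_contra hyz
    have hfx : x ≤ f.2.1 := by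
      have := Prod.Lex.le_iff.mp hf.2.le
      simp only [key, ofLex_toLex] at this
      rcases this with h | h <;> linarith [h, h]
    exact absurd (hmin f (Finset.mem_filter.mpr ⟨hf.1, hfx, y, z, ef, hyz⟩)) hf.2.not_ge
  rw [eg] at e'
  rcases pair_eq_cases e' with ⟨rfl, rfl⟩ | ⟨rfl, rfl⟩
  · exact hcd hc'
  · exact hcd hc'.symm

/-! ### Independent coins -/

/-- The probability of the outcome `b` of independent coins that each show `true` with
probability `d`. -/
noncomputable def coinProb {ι : Type} [Fintype ι] (d : ℝ) (b : ι → Bool) : ℝ :=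
  ∏ x, if b x then d else 1 - d

theorem coinProb_nonneg {ι : Type} [Fintype ι] {d : ℝ} (h0 : 0 ≤ d) (h1 : d ≤ 1) (b : ι → Bool) :
    0 ≤ coinProb d b :=
  Finset.prod_nonneg fun x _ => by split_ifs <;> linarith

theorem sum_coinProb_mul_prod {ι : Type} [Fintype ι] [DecidableEq ι] (d : ℝ) (h : ι → Bool → ℝ) :
    ∑ b : ι → Bool, coinProb d b * ∏ x, h x (b x) =
      ∏ x, (d * h x true + (1 - d) * h x false) := by
  have := Finset.prod_univ_sum (fun _ : ι => (Finset.univ : Finset Bool))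
    (fun x c => (if c then d else 1 - d) * h x c)
  rw [Fintype.piFinset_univ] at this
  simp only [coinProb, ← Finset.prod_mul_distrib]
  rw [← this]
  exact Finset.prod_congr rfl fun x _ => by simp

theorem sum_coinProb {ι : Type} [Fintype ι] [DecidableEq ι] (d : ℝ) :
    ∑ b : ι → Bool, coinProb d b = 1 := by
  have := sum_coinProb_mul_prod (ι := ι) d fun _ _ => 1
  simpa using this

theorem sum_coinProb_avoid {ι : Type} [Fintype ι] [DecidableEq ι] (d : ℝ) (B : Finset ι) :
    (∑ b : ι → Bool, coinProb d b * if ∀ x ∈ B, b x = false then 1 else 0) = (1 - d) ^ B.card := by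
  classical
  have := sum_coinProb_mul_prod d fun (x : ι) c => if x ∈ B then (if c then (0 : ℝ) else 1) else 1
  have e1 : ∀ b : ι → Bool, (∏ x, if x ∈ B then (if b x then (0 : ℝ) else 1) else 1) =
      if ∀ x ∈ B, b x = false then 1 else 0 := by
    intro b
    split_ifs with h
    · exact Finset.prod_eq_one fun x _ => by
        split_ifs with hx hb
        · simp [h x hx] at hb
        · rfl
        · rfl
    · push Not at h
      obtain ⟨x, hx, hb⟩ := h
      exact Finset.prod_eq_zero (Finset.mem_univ x) (by simp [hx, hb])
  simp only [e1] at this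
  rw [this]
  trans ∏ x, if x ∈ B then 1 - d else 1
  · exact Finset.prod_congr rfl fun x _ => by split_ifs <;> simp_all
  · rw [Finset.prod_ite_mem, Finset.univ_inter, Finset.prod_const]

/-! ### One step of the algorithm -/

/-- The vertices whose coin shows `true`. -/
def drawn {V : Type u} [Fintype V] (b : Fin (Fintype.card V) → Bool) : Set V :=
  {y | b (Fintype.equivFin V y) = true}

/-- The marked vertices after the arrival of `g`, where `S` are the edges arrived so far, including
`g`. The edge `g` is accepted if it lies in the greedy forest of `S` and both its endpoints are
unmarked; its head is then marked. Moreover, of the vertices that are not the head of any edge of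
the forest, those in `D` are marked. -/
def step {V : Type u} [Fintype V] (S : Set (Rec V)) (g : Rec V) (D H : Set V) : Set V :=
  H ∪ {b | ∃ a, Heads (greedy S) g a b ∧ a ∉ H ∧ b ∉ H} ∪
    {y | y ∈ D ∧ ∀ g a, ¬ Heads (greedy S) g a y}

/-- The expectation of `φ` after one step, over coins of bias `d`. -/
noncomputable def stepMean {V : Type u} [Fintype V] (d : ℝ) (S : Set (Rec V)) (g : Rec V)
    (φ : Set V → ℝ) (H : Set V) : ℝ :=
  ∑ b : Fin (Fintype.card V) → Bool, coinProb d b * φ (step S g (drawn b) H)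

open scoped Classical in
/-- Indicator of the event that no vertex of `A` is marked. -/
noncomputable def unmarked {V : Type u} (A : Finset V) (H : Set V) : ℝ :=
  if ∀ y ∈ A, y ∉ H then 1 else 0

open scoped Classical in
/-- Indicator of the event that `x` is marked, but no vertex of `A` is. -/
noncomputable def unmarkedMarked {V : Type u} (A : Finset V) (x : V) (H : Set V) : ℝ :=
  if x ∈ H ∧ ∀ y ∈ A, y ∉ H then 1 else 0

open scoped Classical in
/-- The vertices of `A` that are not the head of any edge of `F`. -/
noncomputable def roots {V : Type u} [Fintype V] (F : Set (Rec V)) (A : Finset V) : Finset V :=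
  A.filter fun y => ∀ g a, ¬ Heads F g a y

theorem unmarked_nonneg {V : Type u} (A : Finset V) (H : Set V) : 0 ≤ unmarked A H := by
  unfold unmarked; split_ifs <;> norm_num

theorem unmarkedMarked_nonneg {V : Type u} (A : Finset V) (x : V) (H : Set V) :
    0 ≤ unmarkedMarked A x H := by
  unfold unmarkedMarked; split_ifs <;> norm_num

theorem sum_coinProb_drawn {V : Type u} [Fintype V] (d : ℝ) (B : Finset V) :
    ∑ b : Fin (Fintype.card V) → Bool, coinProb d b * unmarked B (drawn b) =
      (1 - d) ^ B.card := by
  classical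
  rw [← Finset.card_map (Fintype.equivFin V).toEmbedding, ← sum_coinProb_avoid]
  refine Finset.sum_congr rfl fun b _ => ?_
  congr 1
  simp only [unmarked, drawn, Finset.mem_map_equiv]
  congr 1
  refine propext ⟨fun h x hx => ?_, fun h y hy => ?_⟩
  · have := h _ hx; simpa using this
  · have := h (Fintype.equivFin V y) (by simpa using hy); simp [this]

/-- A lower bound for `φ` after the step when the coins avoid `B` yields one in expectation. -/
theorem le_stepMean {V : Type u} [Fintype V] {d : ℝ} (h0 : 0 ≤ d) (h1 : d ≤ 1)
    {S : Set (Rec V)} {g : Rec V} {φ : Set V → ℝ} {H : Set V} (B : Finset V) (c : ℝ)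
    (h : ∀ D : Set V, c * unmarked B D ≤ φ (step S g D H)) :
    (1 - d) ^ B.card * c ≤ stepMean d S g φ H := by
  rw [← sum_coinProb_drawn, Finset.sum_mul]
  refine Finset.sum_le_sum fun b _ => ?_
  rw [mul_assoc, mul_comm (unmarked _ _)]
  exact mul_le_mul_of_nonneg_left (h _) (coinProb_nonneg h0 h1 b)

theorem stepMean_nonneg {V : Type u} [Fintype V] {d : ℝ} (h0 : 0 ≤ d) (h1 : d ≤ 1)
    {S : Set (Rec V)} {g : Rec V} {φ : Set V → ℝ} (hφ : ∀ H, 0 ≤ φ H) (H : Set V) :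
    0 ≤ stepMean d S g φ H :=
  Finset.sum_nonneg fun b _ => mul_nonneg (coinProb_nonneg h0 h1 b) (hφ _)

/-- The edge `g` of `F` has its head in `A`. -/
def HeadsInto {V : Type u} [Fintype V] (F : Set (Rec V)) (g : Rec V) (A : Finset V) : Prop :=
  ∃ y ∈ A, ∃ a, Heads F g a y

theorem notMem_step {V : Type u} [Fintype V] {S : Set (Rec V)} {g : Rec V} {A : Finset V}
    {D H : Set V} (hD : ∀ y ∈ roots (greedy S) A, y ∉ D) (hH : ∀ y ∈ A, y ∉ H)
    (hg : ∀ y ∈ A, ∀ a, Heads (greedy S) g a y → a ∈ H) : ∀ y ∈ A, y ∉ step S g D H := by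
  classical
  rintro y hy ((h | ⟨a, ha, haH, _⟩) | ⟨h, hr⟩)
  · exact hH y hy h
  · exact haH (hg y hy a ha)
  · exact hD y (by simp only [roots, Finset.mem_filter]; exact ⟨hy, hr⟩) h

theorem unmarked_stepMean {V : Type u} [Fintype V] {d : ℝ} (h0 : 0 ≤ d) (h1 : d ≤ 1)
    {S : Set (Rec V)} {g : Rec V} {A : Finset V} (hg : ¬ HeadsInto (greedy S) g A) (H : Set V) :
    (1 - d) ^ (roots (greedy S) A).card * unmarked A H ≤ stepMean d S g (unmarked A) H := by
  refine le_stepMean h0 h1 _ _ fun D => ?_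
  unfold unmarked
  split_ifs with hH hD hs hs
  · norm_num
  · exact absurd (notMem_step hD hH fun y hy a h => absurd ⟨y, hy, a, h⟩ hg) hs
  all_goals norm_num

/-- An arriving edge with its head in `A` is rejected if its tail is marked; then `A` stays
unmarked. -/
theorem unmarked_stepMean_of_heads {V : Type u} [Fintype V] {d : ℝ} (h0 : 0 ≤ d) (h1 : d ≤ 1)
    {S : Set (Rec V)} {g : Rec V} {A : Finset V} {x y : V} (hg : Heads (greedy S) g x y)
    (H : Set V) :
    (1 - d) ^ (roots (greedy S) A).card * unmarkedMarked A x H ≤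
      stepMean d S g (unmarked A) H := by
  refine le_stepMean h0 h1 _ _ fun D => ?_
  unfold unmarked unmarkedMarked
  split_ifs with hH hD hs hs
  · norm_num
  · exact absurd (notMem_step hD hH.2 fun z hz a h => (hg.ends_eq h).1 ▸ hH.1) hs
  all_goals norm_num

theorem unmarkedMarked_stepMean {V : Type u} [Fintype V] {d : ℝ} (h0 : 0 ≤ d) (h1 : d ≤ 1)
    {S : Set (Rec V)} {g : Rec V} {A : Finset V} {x : V} (hg : ¬ HeadsInto (greedy S) g A)
    (H : Set V) :
    (1 - d) ^ (roots (greedy S) A).card * unmarkedMarked A x H ≤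
      stepMean d S g (unmarkedMarked A x) H := by
  refine le_stepMean h0 h1 _ _ fun D => ?_
  unfold unmarked unmarkedMarked
  split_ifs with hH hD hs hs
  · norm_num
  · exact absurd ⟨Or.inl (Or.inl hH.1),
      notMem_step hD hH.2 fun y hy a h => absurd ⟨y, hy, a, h⟩ hg⟩ hs
  all_goals norm_num

/-- If `x` is the head of the arriving edge, whose tail is `z`, and neither `z` nor any vertex of
`A` is marked, then `x` is marked after the step: it is marked already, or the edge is accepted. -/
theorem unmarkedMarked_stepMean_of_heads {V : Type u} [Fintype V] [DecidableEq V] {d : ℝ}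
    (h0 : 0 ≤ d) (h1 : d ≤ 1) {S : Set (Rec V)} {g : Rec V} {A : Finset V} {x z : V} (hx : x ∉ A)
    (hg : Heads (greedy S) g z x) (H : Set V) :
    (1 - d) ^ (roots (greedy S) A).card * unmarked (insert z A) H ≤
      stepMean d S g (unmarkedMarked A x) H := by
  refine le_stepMean h0 h1 _ _ fun D => ?_
  unfold unmarked unmarkedMarked
  split_ifs with hH hD hs hs
  · norm_num
  · refine absurd ⟨?_, notMem_step hD (fun y hy => hH y (Finset.mem_insert_of_mem hy))
      fun y hy a h => absurd ((hg.ends_eq h).2 ▸ hy) hx⟩ hs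
    by_cases hxH : x ∈ H
    · exact Or.inl (Or.inl hxH)
    · exact Or.inl (Or.inr ⟨z, hg, hH z (Finset.mem_insert_self _ _), hxH⟩)
  all_goals norm_num

/-- If `x` is not the head of any edge, its coin marks it with probability `d`. -/
theorem unmarkedMarked_stepMean_of_root {V : Type u} [Fintype V] {d : ℝ} (h0 : 0 ≤ d) (h1 : d ≤ 1)
    {S : Set (Rec V)} {g : Rec V} {A : Finset V} {x : V} (hx : x ∉ A)
    (hroot : ∀ g a, ¬ Heads (greedy S) g a x) (hg : ¬ HeadsInto (greedy S) g A) (H : Set V) :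
    (1 - d) ^ (roots (greedy S) A).card * (d * unmarked A H + (1 - d) * unmarkedMarked A x H) ≤
      stepMean d S g (unmarkedMarked A x) H := by
  classical
  set B := roots (greedy S) A with hB
  have hxB : x ∉ B := fun h => hx (Finset.mem_filter.mp h).1
  -- on the event that `B` is avoided, split according to the coin of `x`
  have e : (1 - d) ^ B.card * (d * unmarked A H + (1 - d) * unmarkedMarked A x H) =
      ∑ b : Fin (Fintype.card V) → Bool, coinProb d b *
        (unmarked B (drawn b) * unmarked A H -
          unmarked (insert x B) (drawn b) * (unmarked A H - unmarkedMarked A x H)) := by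
    have h1 := sum_coinProb_drawn d B
    have h2 := sum_coinProb_drawn d (insert x B)
    rw [Finset.card_insert_of_notMem hxB, pow_succ] at h2
    simp only [mul_sub, ← mul_assoc, Finset.sum_sub_distrib, ← Finset.sum_mul, h1, h2]
    ring
  rw [e]
  refine Finset.sum_le_sum fun b _ => mul_le_mul_of_nonneg_left ?_ (coinProb_nonneg h0 h1 b)
  by_cases hH : ∀ y ∈ A, y ∉ H
  swap
  · have z1 : unmarked A H = 0 := by rw [unmarked, if_neg hH]
    have z2 : unmarkedMarked A x H = 0 := by rw [unmarkedMarked, if_neg fun h => hH h.2]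
    simp only [z1, z2, mul_zero, sub_zero]
    exact unmarkedMarked_nonneg _ _ _
  by_cases hD : ∀ y ∈ B, y ∉ drawn b
  swap
  · have z1 : unmarked B (drawn b) = 0 := by rw [unmarked, if_neg hD]
    have z2 : unmarked (insert x B) (drawn b) = 0 := by
      rw [unmarked, if_neg fun h => hD fun y hy => h y (Finset.mem_insert_of_mem hy)]
    simp only [z1, z2, zero_mul, sub_zero]
    exact unmarkedMarked_nonneg _ _ _
  have hA : ∀ y ∈ A, y ∉ step S g (drawn b) H :=
    notMem_step hD hH fun y hy a h => absurd ⟨y, hy, a, h⟩ hg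
  have z1 : unmarked A H = 1 := by rw [unmarked, if_pos hH]
  have z2 : unmarked B (drawn b) = 1 := by rw [unmarked, if_pos hD]
  rw [z1, z2]
  by_cases hxH : x ∈ H
  · have z3 : unmarkedMarked A x H = 1 := by rw [unmarkedMarked, if_pos ⟨hxH, hH⟩]
    rw [z3, unmarkedMarked, if_pos ⟨Or.inl (Or.inl hxH), hA⟩]; norm_num
  · have z3 : unmarkedMarked A x H = 0 := by rw [unmarkedMarked, if_neg fun h => hxH h.1]
    rw [z3]
    by_cases hxD : x ∈ drawn b
    · rw [unmarkedMarked, if_pos ⟨Or.inr ⟨hxD, hroot⟩, hA⟩]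
      have := unmarked_nonneg (insert x B) (drawn b)
      linarith
    · have z4 : unmarked (insert x B) (drawn b) = 1 := by
        rw [unmarked, if_pos]
        intro y hy
        rcases Finset.mem_insert.mp hy with rfl | hy
        · exact hxD
        · exact hD y hy
      rw [z4]
      have := unmarkedMarked_nonneg A x (step S g (drawn b) H)
      linarith

/-! ### Averaging over the arrival order -/

open scoped Classical in
/-- The edges of `S` other than `g`. -/
noncomputable def del {V : Type u} (S : Finset (Rec V)) (g : Rec V) : Finset (Rec V) := S.erase g

theorem del_subset {V : Type u} (S : Finset (Rec V)) (g : Rec V) : del S g ⊆ S :=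
  Finset.erase_subset _ _

theorem card_del {V : Type u} {S : Finset (Rec V)} {g : Rec V} (hg : g ∈ S) :
    (del S g).card = S.card - 1 := Finset.card_erase_of_mem hg

theorem Proper.del {V : Type u} {S : Finset (Rec V)} (hS : Proper (S : Set (Rec V))) (g : Rec V) :
    Proper (del S g : Set (Rec V)) :=
  hS.mono (Finset.coe_subset.mpr (del_subset S g))

/-- The expectation of `φ` over the marked vertices after the `i` edges of `S` have arrived in
uniformly random order, where the first `k` arrivals are only observed. Recursively, the last edge
to arrive is uniform in `S`; in step `i`, the coins have bias `4 / (5 i)`. -/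
noncomputable def mean {V : Type u} [Fintype V] (k : ℕ) :
    ℕ → Finset (Rec V) → (Set V → ℝ) → ℝ
  | 0, _, φ => φ ∅
  | i + 1, S, φ =>
    if i < k then φ ∅
    else (∑ g ∈ S, mean k i (del S g) (stepMean (4 / 5 / (i + 1 : ℕ)) S g φ)) / (i + 1 : ℕ)

theorem mean_of_le {V : Type u} [Fintype V] {k i : ℕ} (h : i ≤ k) (S : Finset (Rec V))
    (φ : Set V → ℝ) : mean k i S φ = φ ∅ := by
  cases i with
  | zero => rfl
  | succ i => rw [mean, if_pos (Nat.lt_of_succ_le h)]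

theorem bias_nonneg (i : ℕ) : (0 : ℝ) ≤ 4 / 5 / (i + 1 : ℕ) := by positivity

theorem bias_le (i : ℕ) : (4 / 5 / (i + 1 : ℕ) : ℝ) ≤ 1 / (i + 1 : ℕ) := by gcongr; norm_num

theorem bias_le_one (i : ℕ) : (4 / 5 / (i + 1 : ℕ) : ℝ) ≤ 1 := by
  refine (bias_le i).trans ?_
  rw [div_le_one (by positivity)]
  exact_mod_cast Nat.succ_pos i

theorem mean_mono {V : Type u} [Fintype V] {k : ℕ} {i : ℕ} {S : Finset (Rec V)}
    {φ ψ : Set V → ℝ} (h : ∀ H, φ H ≤ ψ H) : mean k i S φ ≤ mean k i S ψ := by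
  induction i generalizing S φ ψ with
  | zero => exact h ∅
  | succ i ih =>
    rw [mean, mean]
    split_ifs
    · exact h ∅
    · refine div_le_div_of_nonneg_right (Finset.sum_le_sum fun g _ => ih fun H => ?_)
        (by positivity)
      exact Finset.sum_le_sum fun b _ =>
        mul_le_mul_of_nonneg_left (h _) (coinProb_nonneg (bias_nonneg i) (bias_le_one i) b)

theorem mean_linear {V : Type u} [Fintype V] {k : ℕ} {i : ℕ} {S : Finset (Rec V)}
    (φ ψ : Set V → ℝ) (r s : ℝ) :
    mean k i S (fun H => r * φ H + s * ψ H) = r * mean k i S φ + s * mean k i S ψ := by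
  induction i generalizing S φ ψ with
  | zero => rfl
  | succ i ih =>
    rw [mean, mean, mean]
    split_ifs
    · rfl
    · have : ∀ g, stepMean (4 / 5 / (i + 1 : ℕ)) S g (fun H => r * φ H + s * ψ H) =
          fun H => r * stepMean (4 / 5 / (i + 1 : ℕ)) S g φ H +
            s * stepMean (4 / 5 / (i + 1 : ℕ)) S g ψ H := by
        intro g
        funext H
        simp only [stepMean, Finset.mul_sum, ← Finset.sum_add_distrib]
        exact Finset.sum_congr rfl fun b _ => by ring
      simp only [this, ih, Finset.sum_add_distrib, ← Finset.mul_sum]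
      ring

theorem mean_const_mul {V : Type u} [Fintype V] {k : ℕ} {i : ℕ} {S : Finset (Rec V)}
    (φ : Set V → ℝ) (r : ℝ) : mean k i S (fun H => r * φ H) = r * mean k i S φ := by
  have := mean_linear (k := k) (i := i) (S := S) φ φ r 0
  simpa using this

theorem mean_nonneg {V : Type u} [Fintype V] {k : ℕ} {i : ℕ} {S : Finset (Rec V)}
    {φ : Set V → ℝ} (h : ∀ H, 0 ≤ φ H) : 0 ≤ mean k i S φ := by
  have h1 := mean_const_mul (k := k) (i := i) (S := S) φ 0
  rw [zero_mul] at h1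
  rw [← h1]
  exact mean_mono fun H => by simpa using h H

/-! ### Bounds on the probability that vertices stay unmarked -/

theorem mean_succ {V : Type u} [Fintype V] {k i : ℕ} (h : k ≤ i)
    (S : Finset (Rec V)) (φ : Set V → ℝ) : mean k (i + 1) S φ = (∑ g ∈ S, mean k i
      (del S g) (stepMean (4 / 5 / (i + 1 : ℕ)) S g φ)) /
        (i + 1 : ℕ) := by
  rw [mean, if_neg (not_lt.mpr h)]

open scoped Classical in
/-- The edges of `S` whose head, in the greedy forest of `S`, lies in `A`. -/
noncomputable def into {V : Type u} [Fintype V] (S : Finset (Rec V)) (A : Finset V) :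
    Finset (Rec V) := S.filter fun g => HeadsInto (greedy (S : Set (Rec V))) g A

/-- Each vertex of `A` is either a root or the head of exactly one edge. -/
theorem card_into_add_card_roots {V : Type u} [Fintype V] {S : Finset (Rec V)}
    (hS : Proper (S : Set (Rec V))) (A : Finset V) :
    (into S A).card + (roots (greedy (S : Set (Rec V))) A).card = A.card := by
  classical
  have hex : ∀ g, g ∈ into S A → ∃ y ∈ A, ∃ a, Heads (greedy (S : Set (Rec V))) g a y :=
    fun g hg => (Finset.mem_filter.mp hg).2
  choose hd hA tl hhd using hex
  have : (into S A).card =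
      (A.filter fun y => ¬ ∀ g a, ¬ Heads (greedy (S : Set (Rec V))) g a y).card := by
    refine Finset.card_bij hd (fun g hg => ?_) (fun g hg g' hg' h => ?_) fun y hy => ?_
    · exact Finset.mem_filter.mpr ⟨hA g hg, fun h => h g _ (hhd g hg)⟩
    · have h' := hhd g' hg'
      rw [← h] at h'
      exact (isForest_greedy hS).heads_unique (hhd g hg) h'
    · obtain ⟨hyA, hy⟩ := Finset.mem_filter.mp hy
      push Not at hy
      obtain ⟨g, a, hg⟩ := hy
      have hgI : g ∈ into S A := Finset.mem_filter.mpr ⟨hg.1.1, y, hyA, a, hg⟩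
      exact ⟨g, hgI, ((hhd g hgI).ends_eq hg).2⟩
  rw [this, roots, add_comm]
  convert Finset.card_filter_add_card_filter_not (s := A)
    (fun y => ∀ g a, ¬ Heads (greedy (S : Set (Rec V))) g a y)

theorem into_subset {V : Type u} [Fintype V] (S : Finset (Rec V)) (A : Finset V) :
    into S A ⊆ S := by
  classical
  exact Finset.filter_subset _ _

theorem mem_into {V : Type u} [Fintype V] {S : Finset (Rec V)} {A : Finset V} {g : Rec V} :
    g ∈ into S A ↔ HeadsInto (greedy (S : Set (Rec V))) g A := by
  classical
  rw [into, Finset.mem_filter]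
  exact ⟨fun h => h.2, fun h => ⟨(by obtain ⟨_, _, _, h⟩ := h; exact h.1.1), h⟩⟩

theorem one_sub_div_le_pow {d I : ℝ} (hI : 1 ≤ I) (hd : d ≤ 1 / I) (b : ℕ) :
    1 - b / I ≤ (1 - d) ^ b := by
  have h1 : 1 / I ≤ 1 := by rw [div_le_one (by linarith)]; exact hI
  calc 1 - b / I = 1 + b * (-(1 / I)) := by ring
    _ ≤ (1 + -(1 / I)) ^ b := one_add_mul_le_pow (by linarith) b
    _ ≤ (1 - d) ^ b := pow_le_pow_left₀ (by linarith) (by linarith) b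

/-- A lower bound for a sum over `S` from a bound `n` on its terms outside `T`. -/
theorem le_sum_of_le_sdiff {α : Type u} [DecidableEq α] {S T : Finset α} (hT : T ⊆ S) {f : α → ℝ}
    {n : ℝ} (h : ∀ g ∈ S, g ∉ T → n ≤ f g) :
    (S.card - T.card : ℝ) * n + ∑ g ∈ T, f g ≤ ∑ g ∈ S, f g := by
  rw [← Finset.sum_sdiff hT]
  gcongr
  have := Finset.card_nsmul_le_sum (S \ T) f n fun g hg =>
    h g (Finset.mem_sdiff.mp hg).1 (Finset.mem_sdiff.mp hg).2
  rw [nsmul_eq_mul, Finset.card_sdiff_of_subset hT,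
    Nat.cast_sub (Finset.card_le_card hT)] at this
  exact this

/-- The union bound: in step `i + 1`, each vertex gets marked with probability at most
`1 / (i + 1)`. -/
theorem le_mean_unmarked {V : Type u} [Fintype V] {a k : ℕ} {C : ℕ → ℝ} (hC0 : ∀ i, 0 ≤ C i)
    (hC1 : ∀ i ≤ k, C i ≤ 1)
    (hC : ∀ i, k ≤ i → C (i + 1) ≤ (1 - a / (i + 1 : ℕ)) * C i) (i : ℕ) {S : Finset (Rec V)}
    (hi : S.card = i) (hS : Proper (S : Set (Rec V))) {A : Finset V} (hA : A.card ≤ a) :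
    C i ≤ mean k i S (unmarked A) := by
  classical
  induction i generalizing S with
  | zero => rw [mean_of_le (Nat.zero_le k)]; simpa [unmarked] using hC1 0 (Nat.zero_le k)
  | succ i ih =>
    rcases lt_or_ge i k with hik | hik
    · rw [mean_of_le hik]; simpa [unmarked] using hC1 _ hik
    rw [mean_succ hik]
    set I : ℝ := ((i + 1 : ℕ) : ℝ) with hI
    have hI1 : 1 ≤ I := by rw [hI]; exact_mod_cast Nat.succ_pos i
    have h0 := bias_nonneg i
    have h1 := bias_le_one i
    rw [← hI] at h0 h1
    set d : ℝ := 4 / 5 / I with hd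
    set r := (roots (greedy (S : Set (Rec V))) A).card with hr
    have hcard := card_into_add_card_roots hS A
    rw [← hr] at hcard
    have hpow : 1 - r / I ≤ (1 - d) ^ r := one_sub_div_le_pow hI1 (by rw [hd]; gcongr; norm_num) r
    have hpow0 : 0 ≤ (1 - d) ^ r := pow_nonneg (by linarith) _
    rw [le_div_iff₀ (by linarith)]
    have hsum := le_sum_of_le_sdiff (into_subset S A) (n := (1 - d) ^ r * C i)
      (f := fun g => mean k i (del S g)
        (stepMean d S g (unmarked A))) (by
        intro g hg hgA
        calc (1 - d) ^ r * C i ≤ (1 - d) ^ r *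
              mean k i (del S g) (unmarked A) := by
              gcongr
              refine ih ?_ (hS.del g)
              rw [card_del hg, hi, Nat.add_sub_cancel]
          _ ≤ _ := by
              rw [← mean_const_mul]
              exact mean_mono fun H => unmarked_stepMean h0 h1 (fun h => hgA (mem_into.mpr h)) H)
    have hnn : 0 ≤ ∑ g ∈ into S A, mean k i (del S g)
        (stepMean d S g (unmarked A)) :=
      Finset.sum_nonneg fun g _ => mean_nonneg (stepMean_nonneg h0 h1 (unmarked_nonneg A))
    refine le_trans ?_ ((le_add_of_nonneg_right hnn).trans hsum)
    have ht : ((into S A).card : ℝ) ≤ I := by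
      rw [hI, ← hi]; exact_mod_cast Finset.card_le_card (into_subset S A)
    rw [hi, ← hI]
    have hsumA : ((into S A).card : ℝ) + r ≤ a := by exact_mod_cast hcard.trans_le hA
    set t : ℝ := ((into S A).card : ℝ) with htdef
    have e1 : (1 - a / I) * I ≤ (I - t) * (1 - d) ^ r := by
      calc (1 - a / I) * I = I - a := by field_simp
        _ ≤ I - t - r := by linarith
        _ ≤ (I - t) * (1 - r / I) := by
          have : (I - t) * (1 - r / I) = I - t - r + t * r / I := by field_simp; ring
          rw [this]
          have : 0 ≤ t * r / I := by positivity
          linarith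
        _ ≤ _ := mul_le_mul_of_nonneg_left hpow (by linarith)
    calc C (i + 1) * I ≤ (1 - a / I) * C i * I := by
          gcongr; exact hC i hik
      _ = (1 - a / I) * I * C i := by ring
      _ ≤ (I - t) * (1 - d) ^ r * C i := mul_le_mul_of_nonneg_right e1 (hC0 i)
      _ = (I - t) * ((1 - d) ^ r * C i) := by ring

/-- Lower bounds for the probability that `A`, a pair of vertices, is unmarked but `x` is marked. In
step `i + 1`, if `x` is not the head of an edge, it is marked by its coin; otherwise, with
probability `1 / (i + 1)` the edge with head `x` arrives, and this suffices if its tail is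
unmarked, too. -/
theorem le_mean_unmarkedMarked {V : Type u} [Fintype V] {k : ℕ} {A₂ A₃ P : ℕ → ℝ}
    (hA₂0 : ∀ i, 0 ≤ A₂ i) (hA₂1 : ∀ i ≤ k, A₂ i ≤ 1)
    (hA₂ : ∀ i, k ≤ i → A₂ (i + 1) ≤ (1 - (2 : ℕ) / (i + 1 : ℕ)) * A₂ i)
    (hA₃0 : ∀ i, 0 ≤ A₃ i) (hA₃1 : ∀ i ≤ k, A₃ i ≤ 1)
    (hA₃ : ∀ i, k ≤ i → A₃ (i + 1) ≤ (1 - (3 : ℕ) / (i + 1 : ℕ)) * A₃ i)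
    (hP0 : ∀ i, 0 ≤ P i) (hPk : ∀ i ≤ k, P i = 0)
    (hPr : ∀ i, k ≤ i → P (i + 1) ≤ (1 - 2 / (i + 1 : ℕ)) *
      (4 / 5 / (i + 1 : ℕ) * A₂ i + (1 - 4 / 5 / (i + 1 : ℕ)) * P i))
    (hPh : ∀ i, k ≤ i → P (i + 1) ≤
      (1 - 3 / (i + 1 : ℕ)) * P i + (1 - 2 / (i + 1 : ℕ)) / (i + 1 : ℕ) * A₃ i)
    (i : ℕ) {S : Finset (Rec V)} (hi : S.card = i) (hS : Proper (S : Set (Rec V)))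
    {A : Finset V} (hA : A.card = 2) {x : V} (hx : x ∉ A) :
    P i ≤ mean k i S (unmarkedMarked A x) := by
  classical
  induction i generalizing S with
  | zero =>
    rw [hPk 0 (Nat.zero_le k)]; exact mean_nonneg (unmarkedMarked_nonneg A x)
  | succ i ih =>
    rcases lt_or_ge i k with hik | hik
    · rw [hPk _ hik]; exact mean_nonneg (unmarkedMarked_nonneg A x)
    rw [mean_succ hik]
    have hPr := hPr i hik
    have hPh := hPh i hik
    set I : ℝ := ((i + 1 : ℕ) : ℝ) with hI
    have hI1 : 1 ≤ I := by rw [hI]; exact_mod_cast Nat.succ_pos i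
    have hI0 : 0 < I := by linarith
    have h0 := bias_nonneg i
    have h1 := bias_le_one i
    rw [← hI] at h0 h1
    set d : ℝ := 4 / 5 / I with hd
    set r := (roots (greedy (S : Set (Rec V))) A).card with hr
    have hcard := card_into_add_card_roots hS A
    rw [← hr, hA] at hcard
    have hpow : 1 - r / I ≤ (1 - d) ^ r := one_sub_div_le_pow hI1 (by rw [hd]; gcongr; norm_num) r
    have hpow0 : 0 ≤ (1 - d) ^ r := pow_nonneg (by linarith) _
    have hr2 : (r : ℝ) = 2 - ((into S A).card : ℝ) := by
      have : ((into S A).card : ℝ) + r = 2 := by exact_mod_cast hcard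
      linarith
    have herase : ∀ g ∈ S, (del S g).card = i := fun g hg => by
      rw [card_del hg, hi, Nat.add_sub_cancel]
    rw [le_div_iff₀ hI0]
    set f : Rec V → ℝ := fun g => mean k i (del S g)
        (stepMean d S g (unmarkedMarked A x)) with hf
    have hfnn : ∀ g, 0 ≤ f g := fun g =>
      mean_nonneg (stepMean_nonneg h0 h1 (unmarkedMarked_nonneg A x))
    have hfP : ∀ g ∈ S, g ∉ into S A → (1 - d) ^ r * P i ≤ f g := by
      intro g hg hgA
      calc (1 - d) ^ r * P i ≤ (1 - d) ^ r *
            mean k i (del S g) (unmarkedMarked A x) := by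
            gcongr
            exact ih (herase g hg) (hS.del g)
        _ ≤ _ := by
            rw [← mean_const_mul]
            exact mean_mono fun H =>
              unmarkedMarked_stepMean h0 h1 (fun h => hgA (mem_into.mpr h)) H
    by_cases hroot : ∀ g a, ¬ Heads (greedy (S : Set (Rec V))) g a x
    · -- `x` is a root
      have hf' : ∀ g ∈ S, g ∉ into S A → (1 - d) ^ r * (d * A₂ i + (1 - d) * P i) ≤ f g := by
        intro g hg hgA
        calc (1 - d) ^ r * (d * A₂ i + (1 - d) * P i) ≤ (1 - d) ^ r *
              (d * mean k i (del S g) (unmarked A) + (1 - d) *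
                mean k i (del S g) (unmarkedMarked A x)) := by
              gcongr
              · exact le_mean_unmarked hA₂0 hA₂1 hA₂ i (herase g hg) (hS.del g) hA.le
              · exact ih (herase g hg) (hS.del g)
          _ ≤ _ := by
              rw [← mean_linear, ← mean_const_mul]
              exact mean_mono fun H => unmarkedMarked_stepMean_of_root h0 h1 hx hroot
                (fun h => hgA (mem_into.mpr h)) H
      have hsum := le_sum_of_le_sdiff (into_subset S A) hf'
      have hnn : 0 ≤ ∑ g ∈ into S A, f g := Finset.sum_nonneg fun g _ => hfnn g
      refine le_trans ?_ ((le_add_of_nonneg_right hnn).trans hsum)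
      have ht : ((into S A).card : ℝ) ≤ I := by
        rw [hI, ← hi]; exact_mod_cast Finset.card_le_card (into_subset S A)
      rw [hi, ← hI]
      set t : ℝ := ((into S A).card : ℝ) with htdef
      have e1 : (1 - 2 / I) * I ≤ (I - t) * (1 - d) ^ r := by
        calc (1 - 2 / I) * I = I - t - r := by rw [hr2]; field_simp; ring
          _ ≤ (I - t) * (1 - r / I) := by
            have : (I - t) * (1 - r / I) = I - t - r + t * r / I := by field_simp; ring
            rw [this]
            have : 0 ≤ t * r / I := by positivity
            linarith
          _ ≤ _ := mul_le_mul_of_nonneg_left hpow (by linarith)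
      have hX : 0 ≤ d * A₂ i + (1 - d) * P i :=
        add_nonneg (mul_nonneg h0 (hA₂0 i)) (mul_nonneg (by linarith) (hP0 i))
      calc P (i + 1) * I ≤ (1 - 2 / I) * (d * A₂ i + (1 - d) * P i) * I := by gcongr
        _ = (1 - 2 / I) * I * (d * A₂ i + (1 - d) * P i) := by ring
        _ ≤ (I - t) * (1 - d) ^ r * (d * A₂ i + (1 - d) * P i) :=
          mul_le_mul_of_nonneg_right e1 hX
        _ = _ := by ring
    · -- `x` is the head of `h`, whose tail is `z`
      push Not at hroot
      obtain ⟨h, z, hz⟩ := hroot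
      have hhS : h ∈ S := hz.1.1
      have hhA : h ∉ into S A := by
        rw [mem_into]
        rintro ⟨y, hy, a, hya⟩
        exact hx ((hz.ends_eq hya).2 ▸ hy)
      have hfh : (1 - d) ^ r * A₃ i ≤ f h := by
        calc (1 - d) ^ r * A₃ i ≤ (1 - d) ^ r *
              mean k i (del S h) (unmarked (insert z A)) := by
              gcongr
              refine le_mean_unmarked hA₃0 hA₃1 hA₃ i (herase h hhS) (hS.del h) ?_
              exact (Finset.card_insert_le _ _).trans (by rw [hA])
          _ ≤ _ := by
              rw [← mean_const_mul]
              exact mean_mono fun H => unmarkedMarked_stepMean_of_heads h0 h1 hx hz H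
      have hsub : insert h (into S A) ⊆ S := Finset.insert_subset hhS (into_subset S A)
      have hsum := le_sum_of_le_sdiff hsub (n := (1 - d) ^ r * P i) (f := f) fun g hg hgA =>
        hfP g hg fun h' => hgA (Finset.mem_insert_of_mem h')
      have ht : ((insert h (into S A)).card : ℝ) ≤ I := by
        rw [hI, ← hi]; exact_mod_cast Finset.card_le_card hsub
      rw [Finset.sum_insert hhA] at hsum
      rw [Finset.card_insert_of_notMem hhA] at hsum ht
      have hnn : 0 ≤ ∑ g ∈ into S A, f g := Finset.sum_nonneg fun g _ => hfnn g
      push_cast at hsum ht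
      rw [hi, ← hI] at hsum
      set t : ℝ := ((into S A).card : ℝ) with htdef
      have ht0 : 0 ≤ t := by positivity
      have e1 : (1 - 3 / I) * I ≤ (I - (t + 1)) * (1 - d) ^ r := by
        calc (1 - 3 / I) * I = I - (t + 1) - r := by rw [hr2]; field_simp; ring
          _ ≤ (I - (t + 1)) * (1 - r / I) := by
            have : (I - (t + 1)) * (1 - r / I) = I - (t + 1) - r + (t + 1) * r / I := by
              field_simp; ring
            rw [this]
            have : 0 ≤ (t + 1) * r / I := by positivity
            linarith
          _ ≤ _ := mul_le_mul_of_nonneg_left hpow (by linarith)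
      have e2 : 1 - 2 / I ≤ (1 - d) ^ r := by
        refine le_trans ?_ hpow
        gcongr
        linarith
      calc P (i + 1) * I ≤ ((1 - 3 / I) * P i + (1 - 2 / I) / I * A₃ i) * I := by gcongr
        _ = (1 - 3 / I) * I * P i + (1 - 2 / I) * A₃ i := by field_simp
        _ ≤ (I - (t + 1)) * (1 - d) ^ r * P i + (1 - d) ^ r * A₃ i :=
          add_le_add (mul_le_mul_of_nonneg_right e1 (hP0 i))
            (mul_le_mul_of_nonneg_right e2 (hA₃0 i))
        _ ≤ _ := by linarith

theorem Heads.ne {V : Type u} [Fintype V] {F : Set (Rec V)} {g : Rec V} {a b : V}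
    (h : Heads F g a b) : a ≠ b := by
  rintro rfl
  exact h.2.2.asymm h.2.2

open scoped Classical in
/-- The edges of the greedy forest of `S` with endpoints `u` and `v`. -/
noncomputable def parallel {V : Type u} (S : Finset (Rec V)) (u v : V) : Finset (Rec V) :=
  S.filter fun g => g ∈ greedy (S : Set (Rec V)) ∧ g.1 = {u, v}

theorem card_parallel_le_one {V : Type u} {S : Finset (Rec V)}
    (hS : Proper (S : Set (Rec V))) (u v : V) : (parallel S u v).card ≤ 1 := by
  classical
  rw [Finset.card_le_one]
  intro g hg g' hg'
  obtain ⟨_, hg, e⟩ := Finset.mem_filter.mp hg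
  obtain ⟨_, hg', e'⟩ := Finset.mem_filter.mp hg'
  by_contra hne
  exact isForest_greedy hS g hg u v e
    (Conn.of_mem (Set.mem_sdiff_of_mem hg' (Ne.symm hne : g' ≠ g)) e')

/-- Lower bounds for the probability that both `u` and `v` are unmarked. Let the arriving edge have
its head in `{u, v}`. If its tail `x` is not in `{u, v}`, the edge is rejected provided that `x` is
marked, which is accounted for by the bounds `P`. The tail is in `{u, v}` only for the edges
parallel to `uv`, of which the forest contains at most `c`. If `u` or `v` is a root, it is marked by
its coin with probability `4 / (5 (i + 1))` only, which makes up for the missing term. -/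
theorem le_mean_unmarked_pair {V : Type u} [Fintype V] [DecidableEq V] {k c : ℕ} (hc : c ≤ 1)
    {P N : ℕ → ℝ} {u v : V} (huv : u ≠ v)
    (hP : ∀ (i : ℕ) (S : Finset (Rec V)), S.card = i → Proper (S : Set (Rec V)) →
      ∀ x ∉ ({u, v} : Finset V), P i ≤ mean k i S (unmarkedMarked {u, v} x))
    (hP0 : ∀ i, 0 ≤ P i) (hPN : ∀ i, P i ≤ 1 / 5 * N i) (hN1 : ∀ i ≤ k, N i ≤ 1)
    (hN : ∀ i, k ≤ i →
      N (i + 1) ≤ (1 - 2 / (i + 1 : ℕ)) * N i + (2 - c) / (i + 1 : ℕ) * P i)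
    (i : ℕ) {S : Finset (Rec V)} (hi : S.card = i) (hS : Proper (S : Set (Rec V)))
    (hpar : ∀ S' ⊆ S, (parallel S' u v).card ≤ c) :
    N i ≤ mean k i S (unmarked {u, v}) := by
  classical
  induction i generalizing S with
  | zero => rw [mean_of_le (Nat.zero_le k)]; simpa [unmarked] using hN1 0 (Nat.zero_le k)
  | succ i ih =>
    rcases lt_or_ge i k with hik | hik
    · rw [mean_of_le hik]; simpa [unmarked] using hN1 _ hik
    rw [mean_succ hik]
    have hN := hN i hik
    set A : Finset V := {u, v} with hAdef
    have hA : A.card = 2 := Finset.card_pair huv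
    set I : ℝ := ((i + 1 : ℕ) : ℝ) with hI
    have hI1 : 1 ≤ I := by rw [hI]; exact_mod_cast Nat.succ_pos i
    have hI0 : 0 < I := by linarith
    have h0 := bias_nonneg i
    have h1 := bias_le_one i
    rw [← hI] at h0 h1
    set d : ℝ := 4 / 5 / I with hd
    have hdI : d * I = 4 / 5 := by rw [hd]; field_simp
    set r := (roots (greedy (S : Set (Rec V))) A).card with hr
    have hcard := card_into_add_card_roots hS A
    rw [← hr, hA] at hcard
    have hpow0 : 0 ≤ (1 - d) ^ r := pow_nonneg (by linarith) _
    have herase : ∀ g ∈ S, (del S g).card = i := fun g hg => by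
      rw [card_del hg, hi, Nat.add_sub_cancel]
    rw [le_div_iff₀ hI0]
    set f : Rec V → ℝ := fun g => mean k i (del S g) (stepMean d S g (unmarked A)) with hf
    have hfnn : ∀ g, 0 ≤ f g := fun g =>
      mean_nonneg (stepMean_nonneg h0 h1 (unmarked_nonneg A))
    have hfN : ∀ g ∈ S, g ∉ into S A → (1 - d) ^ r * N i ≤ f g := by
      intro g hg hgA
      calc (1 - d) ^ r * N i ≤ (1 - d) ^ r * mean k i (del S g) (unmarked A) := by
            gcongr
            exact ih (herase g hg) (hS.del g) fun S' hS' => hpar S' (hS'.trans (del_subset S g))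
        _ ≤ _ := by
            rw [← mean_const_mul]
            exact mean_mono fun H => unmarked_stepMean h0 h1 (fun h => hgA (mem_into.mpr h)) H
    set Q := (into S A) ∩ parallel S u v with hQ
    have hfP : ∀ g ∈ into S A, g ∉ Q → (1 - d) ^ r * P i ≤ f g := by
      intro g hg hgQ
      have hgS := into_subset S A hg
      obtain ⟨y, hy, x, hxy⟩ := mem_into.mp hg
      have hx : x ∉ A := by
        intro hx
        refine hgQ (Finset.mem_inter.mpr ⟨hg, Finset.mem_filter.mpr ⟨hgS, hxy.1, ?_⟩⟩)
        rw [hxy.2.1]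
        have hne := hxy.ne
        rw [hAdef, Finset.mem_insert, Finset.mem_singleton] at hx hy
        rcases hx with rfl | rfl <;> rcases hy with rfl | rfl
        · exact absurd rfl hne
        · rfl
        · exact Set.pair_comm _ _
        · exact absurd rfl hne
      calc (1 - d) ^ r * P i ≤ (1 - d) ^ r * mean k i (del S g) (unmarkedMarked A x) := by
            gcongr
            exact hP i _ (herase g hgS) (hS.del g) x hx
        _ ≤ _ := by
            rw [← mean_const_mul]
            exact mean_mono fun H => unmarked_stepMean_of_heads h0 h1 hxy H
    have hsum := le_sum_of_le_sdiff (into_subset S A) hfN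
    have hsum' := le_sum_of_le_sdiff (Finset.inter_subset_left (s₂ := parallel S u v)) hfP
    have hnn : 0 ≤ ∑ g ∈ Q, f g := Finset.sum_nonneg fun g _ => hfnn g
    have hqc : (Q.card : ℝ) ≤ c := by
      exact_mod_cast (Finset.card_le_card Finset.inter_subset_right).trans (hpar S subset_rfl)
    have hqt : (Q.card : ℝ) ≤ (into S A).card := by
      exact_mod_cast Finset.card_le_card Finset.inter_subset_left
    have hc1 : (c : ℝ) ≤ 1 := by exact_mod_cast hc
    have hc0 : (0 : ℝ) ≤ c := by positivity
    rw [hi, ← hI] at hsum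
    rw [← hQ] at hsum'
    have hti : ((into S A).card : ℝ) ≤ I := by
      rw [hI, ← hi]; exact_mod_cast Finset.card_le_card (into_subset S A)
    have htr : ((into S A).card : ℝ) = 2 - r := by
      have : ((into S A).card : ℝ) + r = 2 := by exact_mod_cast hcard
      linarith
    set t : ℝ := ((into S A).card : ℝ) with htdef
    set q : ℝ := (Q.card : ℝ) with hqdef
    have hq0 : 0 ≤ q := by positivity
    have hPi := hP0 i
    have hPNi := hPN i
    have hNi : 0 ≤ N i := by linarith
    have hgoal : N (i + 1) * I ≤ (1 - d) ^ r * ((I - t) * N i + (t - q) * P i) := by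
      have e0 : N (i + 1) * I ≤ (I - 2) * N i + (2 - c) * P i := by
        calc N (i + 1) * I ≤ ((1 - 2 / I) * N i + (2 - c) / I * P i) * I := by gcongr
          _ = _ := by field_simp
      refine e0.trans ?_
      have hr2 : r ≤ 2 := by omega
      have hcP : 0 ≤ c * P i := mul_nonneg hc0 hPi
      have hqP : q * P i ≤ c * P i := mul_le_mul_of_nonneg_right hqc hPi
      have hqP0 : 0 ≤ q * P i := mul_nonneg hq0 hPi
      interval_cases r
      · -- both `u` and `v` are heads
        have : t = 2 := by rw [htr]; norm_num
        rw [this, pow_zero, one_mul]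
        linarith
      · have : t = 1 := by rw [htr]; norm_num
        rw [this] at hqt hti ⊢
        rw [pow_one]
        have hXN : (I - 1) * N i + (1 - q) * P i ≤ I * N i := by linarith
        have : d * ((I - 1) * N i + (1 - q) * P i) ≤ 4 / 5 * N i := by
          calc d * ((I - 1) * N i + (1 - q) * P i) ≤ d * (I * N i) := by gcongr
            _ = 4 / 5 * N i := by rw [← mul_assoc, hdI]
        linarith
      · have : t = 0 := by rw [htr]; norm_num
        have hq : q = 0 := le_antisymm (by linarith) hq0
        rw [this, hq]
        have e : (1 - d) ^ 2 * ((I - 0) * N i + (0 - 0) * P i) =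
            (I - 2 * (d * I) + d * (d * I)) * N i := by ring
        rw [e, hdI]
        linarith [mul_nonneg h0 hNi]
    calc N (i + 1) * I ≤ (1 - d) ^ r * ((I - t) * N i + (t - q) * P i) := hgoal
      _ = (I - t) * ((1 - d) ^ r * N i) + (t - q) * ((1 - d) ^ r * P i) := by ring
      _ ≤ _ := by linarith

/-! ### The numerical bounds -/

/-- `∏ (1 - 2 / j)` over `k < j ≤ i`. -/
noncomputable def twoBound (k i : ℕ) : ℝ :=
  if i < k then 0 else (k * (k - 1)) / (i * (i - 1))

/-- `∏ (1 - 3 / j)` over `k < j ≤ i`. -/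
noncomputable def threeBound (k i : ℕ) : ℝ :=
  if i < k then 0 else (k * (k - 1) * (k - 2)) / (i * (i - 1) * (i - 2))

/-- The bound for the probability that two vertices are unmarked and a third one is marked. -/
noncomputable def markedBound (k i : ℕ) : ℝ :=
  if i < k then 0 else 4 / 5 * threeBound k i * (1 - k / i)

/-- The bound for the probability that two vertices are unmarked. The parameter `c` is the number of
edges in the forest that join these vertices. -/
noncomputable def pairBound (c k i : ℕ) : ℝ :=
  if i < k then 0 else twoBound k i * (1 + (2 - c) / 2 * (4 / 5 * ((k - 2) / (k - 1)) *
    ((i - k) * (i - k - 1) / ((i - 1) * (i - 2)))))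

theorem sub_mul_sub_nonneg {i k : ℕ} (h : k ≤ i) : (0 : ℝ) ≤ ((i : ℝ) - k) * (i - k - 1) := by
  rcases h.eq_or_lt with rfl | h
  · simp
  · have : (k : ℝ) + 1 ≤ i := by exact_mod_cast h
    exact mul_nonneg (by linarith) (by linarith)

theorem twoBound_nonneg {k : ℕ} (hk : 3 ≤ k) (i : ℕ) : 0 ≤ twoBound k i := by
  unfold twoBound
  split_ifs with h
  · exact le_rfl
  · have hk : (3 : ℝ) ≤ k := by exact_mod_cast hk
    have hi : (k : ℝ) ≤ i := by exact_mod_cast not_lt.mp h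
    exact div_nonneg (mul_nonneg (by linarith) (by linarith))
      (mul_nonneg (by linarith) (by linarith))

theorem threeBound_nonneg {k : ℕ} (hk : 3 ≤ k) (i : ℕ) : 0 ≤ threeBound k i := by
  unfold threeBound
  split_ifs with h
  · exact le_rfl
  · have hk : (3 : ℝ) ≤ k := by exact_mod_cast hk
    have hi : (k : ℝ) ≤ i := by exact_mod_cast not_lt.mp h
    exact div_nonneg (mul_nonneg (mul_nonneg (by linarith) (by linarith)) (by linarith))
      (mul_nonneg (mul_nonneg (by linarith) (by linarith)) (by linarith))

theorem markedBound_nonneg {k : ℕ} (hk : 3 ≤ k) (i : ℕ) : 0 ≤ markedBound k i := by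
  unfold markedBound
  split_ifs with h
  · exact le_rfl
  · have hk' : (3 : ℝ) ≤ k := by exact_mod_cast hk
    have hi : (k : ℝ) ≤ i := by exact_mod_cast not_lt.mp h
    have h1 : (k : ℝ) / i ≤ 1 := by rw [div_le_one (by linarith)]; exact hi
    exact mul_nonneg (mul_nonneg (by norm_num) (threeBound_nonneg hk i)) (by linarith)

theorem twoBound_le_one {k : ℕ} (i : ℕ) (h : i ≤ k) : twoBound k i ≤ 1 := by
  unfold twoBound
  split_ifs with h'
  · exact zero_le_one
  · obtain rfl := le_antisymm h (not_lt.mp h')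
    exact div_self_le_one _

theorem threeBound_le_one {k : ℕ} (i : ℕ) (h : i ≤ k) : threeBound k i ≤ 1 := by
  unfold threeBound
  split_ifs with h'
  · exact zero_le_one
  · obtain rfl := le_antisymm h (not_lt.mp h')
    exact div_self_le_one _

theorem markedBound_eq_zero {k : ℕ} (hk : 3 ≤ k) (i : ℕ) (h : i ≤ k) : markedBound k i = 0 := by
  unfold markedBound
  split_ifs with h'
  · rfl
  · obtain rfl := le_antisymm h (not_lt.mp h')
    have : (i : ℝ) ≠ 0 := by positivity
    rw [div_self this, sub_self, mul_zero]

theorem pairBound_le_one {c k : ℕ} (i : ℕ) (h : i ≤ k) : pairBound c k i ≤ 1 := by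
  unfold pairBound
  split_ifs with h'
  · exact zero_le_one
  · obtain rfl := le_antisymm h (not_lt.mp h')
    simpa using twoBound_le_one (k := i) i le_rfl

theorem twoBound_succ {k : ℕ} (hk : 3 ≤ k) (i : ℕ) (h : k ≤ i) :
    twoBound k (i + 1) ≤ (1 - (2 : ℕ) / (i + 1 : ℕ)) * twoBound k i := by
  have hk' : (3 : ℝ) ≤ k := by exact_mod_cast hk
  have hi : (k : ℝ) ≤ i := by exact_mod_cast h
  rw [twoBound, twoBound, if_neg (by omega), if_neg (by omega)]
  push_cast
  apply le_of_eq
  have h1 : (i : ℝ) ≠ 0 := by linarith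
  have h2 : (i : ℝ) - 1 ≠ 0 := by linarith
  have h3 : (i : ℝ) + 1 ≠ 0 := by linarith
  rw [add_sub_cancel_right]
  field_simp
  ring

theorem threeBound_succ {k : ℕ} (hk : 3 ≤ k) (i : ℕ) (h : k ≤ i) :
    threeBound k (i + 1) ≤ (1 - (3 : ℕ) / (i + 1 : ℕ)) * threeBound k i := by
  have hk' : (3 : ℝ) ≤ k := by exact_mod_cast hk
  have hi : (k : ℝ) ≤ i := by exact_mod_cast h
  rw [threeBound, threeBound, if_neg (by omega), if_neg (by omega)]
  push_cast
  apply le_of_eq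
  have h1 : (i : ℝ) ≠ 0 := by linarith
  have h2 : (i : ℝ) - 1 ≠ 0 := by linarith
  have h3 : (i : ℝ) + 1 ≠ 0 := by linarith
  have h4 : (i : ℝ) - 2 ≠ 0 := by linarith
  have e : (i : ℝ) + 1 - 2 = i - 1 := by ring
  rw [add_sub_cancel_right, e]
  field_simp
  ring

theorem markedBound_succ_root {k : ℕ} (hk : 3 ≤ k) (i : ℕ) (h : k ≤ i) :
    markedBound k (i + 1) ≤ (1 - 2 / (i + 1 : ℕ)) * (4 / 5 / (i + 1 : ℕ) * twoBound k i +
      (1 - 4 / 5 / (i + 1 : ℕ)) * markedBound k i) := by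
  have hk' : (3 : ℝ) ≤ k := by exact_mod_cast hk
  have hi : (k : ℝ) ≤ i := by exact_mod_cast h
  rw [markedBound, markedBound, threeBound, threeBound, twoBound]
  simp only [if_neg (show ¬ i < k by omega), if_neg (show ¬ i + 1 < k by omega)]
  push_cast
  have h1 : 0 < (i : ℝ) := by linarith
  have h2 : 0 < (i : ℝ) - 1 := by linarith
  have h4 : 0 < (i : ℝ) - 2 := by linarith
  generalize (i : ℝ) = x at *
  generalize (k : ℝ) = y at *
  have e : x + 1 - 2 = x - 1 := by ring
  rw [add_sub_cancel_right, e]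
  have key : (y - 2) * (x + 1 - y) / (x - 1) ≤
      1 + (x + 1 / 5) * (y - 2) * (x - y) / (x * (x - 2)) := by
    have a1 : (y - 2) * (x - y) / (x - 1) ≤ (y - 2) * (x - y) / (x - 2) := by
      have : 0 ≤ (y - 2) * (x - y) := mul_nonneg (by linarith) (by linarith)
      gcongr
      linarith
    have a2 : (y - 2) * (x - y) / (x - 2) ≤ (x + 1 / 5) * (y - 2) * (x - y) / (x * (x - 2)) := by
      rw [div_le_div_iff₀ h4 (by positivity)]
      have : 0 ≤ (y - 2) * (x - y) * (x - 2) :=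
        mul_nonneg (mul_nonneg (by linarith) (by linarith)) h4.le
      linarith
    have a3 : (y - 2) / (x - 1) ≤ 1 := by rw [div_le_one h2]; linarith
    have a4 : (y - 2) * (x + 1 - y) / (x - 1) =
        (y - 2) * (x - y) / (x - 1) + (y - 2) / (x - 1) := by ring
    linarith
  have hf : 0 ≤ 4 / 5 * (y * (y - 1)) / ((x + 1) ^ 2 * x) :=
    div_nonneg (mul_nonneg (by norm_num) (mul_nonneg (by linarith) (by linarith))) (by positivity)
  calc 4 / 5 * (y * (y - 1) * (y - 2) / ((x + 1) * x * (x - 1))) * (1 - y / (x + 1))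
      = 4 / 5 * (y * (y - 1)) / ((x + 1) ^ 2 * x) * ((y - 2) * (x + 1 - y) / (x - 1)) := by
        field_simp
    _ ≤ 4 / 5 * (y * (y - 1)) / ((x + 1) ^ 2 * x) *
        (1 + (x + 1 / 5) * (y - 2) * (x - y) / (x * (x - 2))) :=
        mul_le_mul_of_nonneg_left key hf
    _ = _ := by field_simp; ring

theorem markedBound_succ_head {k : ℕ} (hk : 3 ≤ k) (i : ℕ) (h : k ≤ i) :
    markedBound k (i + 1) ≤ (1 - 3 / (i + 1 : ℕ)) * markedBound k i +
      (1 - 2 / (i + 1 : ℕ)) / (i + 1 : ℕ) * threeBound k i := by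
  have hk' : (3 : ℝ) ≤ k := by exact_mod_cast hk
  have hi : (k : ℝ) ≤ i := by exact_mod_cast h
  rw [markedBound, markedBound, threeBound, threeBound]
  simp only [if_neg (show ¬ i < k by omega), if_neg (show ¬ i + 1 < k by omega)]
  push_cast
  have h1 : 0 < (i : ℝ) := by linarith
  have h2 : 0 < (i : ℝ) - 1 := by linarith
  have h4 : 0 < (i : ℝ) - 2 := by linarith
  generalize (i : ℝ) = x at *
  generalize (k : ℝ) = y at *
  have e : x + 1 - 2 = x - 1 := by ring
  rw [add_sub_cancel_right, e]
  have key : 4 / 5 * (x + 1 - y) / (x + 1) ≤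
      4 / 5 * (x - y) / x + (x - 1) / ((x + 1) * (x - 2)) := by
    have a1 : 4 / 5 * (x + 1 - y) / (x + 1) - 4 / 5 * (x - y) / x =
        4 / 5 * y / (x * (x + 1)) := by field_simp; ring
    have a2 : 4 / 5 * y / (x * (x + 1)) ≤ 1 / (x + 1) := by
      rw [div_le_div_iff₀ (by positivity) (by positivity)]
      have : y * (x + 1) ≤ x * (x + 1) := by gcongr
      have : 0 ≤ x * (x + 1) := by positivity
      linarith
    have a3 : 1 / (x + 1) ≤ (x - 1) / ((x + 1) * (x - 2)) := by
      rw [div_le_div_iff₀ (by positivity) (by positivity)]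
      have : (x - 1) * (x + 1) - 1 * ((x + 1) * (x - 2)) = x + 1 := by ring
      linarith
    linarith
  have hf : 0 ≤ y * (y - 1) * (y - 2) / ((x + 1) * x * (x - 1)) :=
    div_nonneg (mul_nonneg (mul_nonneg (by linarith) (by linarith)) (by linarith)) (by positivity)
  calc 4 / 5 * (y * (y - 1) * (y - 2) / ((x + 1) * x * (x - 1))) * (1 - y / (x + 1))
      = y * (y - 1) * (y - 2) / ((x + 1) * x * (x - 1)) * (4 / 5 * (x + 1 - y) / (x + 1)) := by
        field_simp
    _ ≤ y * (y - 1) * (y - 2) / ((x + 1) * x * (x - 1)) *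
        (4 / 5 * (x - y) / x + (x - 1) / ((x + 1) * (x - 2))) :=
        mul_le_mul_of_nonneg_left key hf
    _ = _ := by field_simp; ring

theorem markedBound_le_pairBound {c k : ℕ} (hc : c ≤ 1) (hk : 3 ≤ k) (i : ℕ) :
    markedBound k i ≤ 1 / 5 * pairBound c k i := by
  have hk' : (3 : ℝ) ≤ k := by exact_mod_cast hk
  have hc' : (c : ℝ) ≤ 1 := by exact_mod_cast hc
  rw [markedBound, pairBound, threeBound, twoBound]
  split_ifs with h
  · norm_num
  have hi : (k : ℝ) ≤ i := by exact_mod_cast not_lt.mp h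
  have hg := sub_mul_sub_nonneg (not_lt.mp h)
  have h1 : 0 < (i : ℝ) := by linarith
  have h2 : 0 < (i : ℝ) - 1 := by linarith
  have h4 : 0 < (i : ℝ) - 2 := by linarith
  generalize (i : ℝ) = x at *
  generalize (k : ℝ) = y at *
  have hG : 0 ≤ (2 - (c : ℝ)) / 2 * (4 / 5 * ((y - 2) / (y - 1)) *
      ((x - y) * (x - y - 1) / ((x - 1) * (x - 2)))) := by
    have : 0 ≤ (y - 2) / (y - 1) := div_nonneg (by linarith) (by linarith)
    have : 0 ≤ (2 - (c : ℝ)) / 2 := by linarith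
    positivity
  have hf : 0 ≤ y * (y - 1) / (x * (x - 1)) :=
    div_nonneg (mul_nonneg (by linarith) (by linarith)) (by positivity)
  -- by the inequality of arithmetic and geometric means
  have key : 4 * ((y - 2) * (x - y)) / (x * (x - 2)) ≤ 1 := by
    rw [div_le_one (by positivity)]
    have : (x - 2) ^ 2 - 4 * ((y - 2) * (x - y)) = (x - 2 * y + 2) ^ 2 := by ring
    have : 0 ≤ (x - 2 * y + 2) ^ 2 := sq_nonneg _
    have : x * (x - 2) - (x - 2) ^ 2 = 2 * (x - 2) := by ring
    linarith
  calc 4 / 5 * (y * (y - 1) * (y - 2) / (x * (x - 1) * (x - 2))) * (1 - y / x)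
      = 1 / 5 * (y * (y - 1) / (x * (x - 1)) * (4 * ((y - 2) * (x - y)) / (x * (x - 2)))) := by
        field_simp
    _ ≤ _ := by
        refine mul_le_mul_of_nonneg_left (mul_le_mul_of_nonneg_left ?_ hf) (by norm_num)
        linarith

theorem pairBound_succ {c k : ℕ} (hk : 3 ≤ k) (i : ℕ) (h : k ≤ i) :
    pairBound c k (i + 1) ≤ (1 - 2 / (i + 1 : ℕ)) * pairBound c k i +
      (2 - c) / (i + 1 : ℕ) * markedBound k i := by
  have hk' : (3 : ℝ) ≤ k := by exact_mod_cast hk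
  have hi : (k : ℝ) ≤ i := by exact_mod_cast h
  rw [markedBound, pairBound, pairBound, threeBound, twoBound, twoBound]
  simp only [if_neg (show ¬ i < k by omega), if_neg (show ¬ i + 1 < k by omega)]
  push_cast
  have h1 : 0 < (i : ℝ) := by linarith
  have h2 : 0 < (i : ℝ) - 1 := by linarith
  have h4 : 0 < (i : ℝ) - 2 := by linarith
  have h5 : 0 < (k : ℝ) - 1 := by linarith
  generalize (i : ℝ) = x at *
  generalize (k : ℝ) = y at *
  generalize (c : ℝ) = z at *
  have e : x + 1 - 2 = x - 1 := by ring
  rw [add_sub_cancel_right, e]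
  apply le_of_eq
  field_simp
  ring

theorem sum_pairBound_ge {c k : ℕ} (hc : c ≤ 1) (hk : 3 ≤ k) (M : ℕ) (hM : k ≤ M) :
    (k * (M - k) / (M - 1) + (2 - c) / 2 * (4 / 5) * (k - 2) / 3 *
      ((M - k) * (M - k - 1) * (M - k - 2) / (M * (M - 1) * (M - 2))) : ℝ) ≤
      ∑ j ∈ Finset.Ico k M, pairBound c k j := by
  have hk' : (3 : ℝ) ≤ k := by exact_mod_cast hk
  have hc' : (c : ℝ) ≤ 1 := by exact_mod_cast hc
  induction M, hM using Nat.le_induction with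
  | base => simp
  | succ i h ih =>
    rw [Finset.sum_Ico_succ_top h]
    refine le_trans ?_ (add_le_add_left ih _)
    have hi : (k : ℝ) ≤ i := by exact_mod_cast h
    have hg := sub_mul_sub_nonneg h
    rw [pairBound, twoBound, if_neg (by omega), if_neg (by omega)]
    push_cast
    have h1 : 0 < (i : ℝ) := by linarith
    have h2 : 0 < (i : ℝ) - 1 := by linarith
    have h4 : 0 < (i : ℝ) - 2 := by linarith
    have h5 : 0 < (k : ℝ) - 1 := by linarith
    generalize (i : ℝ) = x at *
    generalize (k : ℝ) = y at *
    generalize (c : ℝ) = z at *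
    have e : x + 1 - 2 = x - 1 := by ring
    rw [add_sub_cancel_right, e]
    have e1 : y * (x + 1 - y) / x = y * (x - y) / (x - 1) + y * (y - 1) / (x * (x - 1)) := by
      field_simp; ring
    have hW : 0 ≤ (2 - z) / 2 * (4 / 5) * (y - 2) * y * ((x - y) * (x - y - 1)) /
        (x * (x - 1) * (x - 2)) := by
      refine div_nonneg (mul_nonneg (mul_nonneg (mul_nonneg ?_ ?_) ?_) hg) (by positivity)
      all_goals linarith
    have e2 : (2 - z) / 2 * (4 / 5) * (y - 2) / 3 *
        ((x + 1 - y) * (x + 1 - y - 1) * (x + 1 - y - 2) / ((x + 1) * x * (x - 1))) =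
        (2 - z) / 2 * (4 / 5) * (y - 2) / 3 *
          ((x - y) * (x - y - 1) * (x - y - 2) / (x * (x - 1) * (x - 2))) +
        (2 - z) / 2 * (4 / 5) * (y - 2) * y * ((x - y) * (x - y - 1)) /
          (x * (x - 1) * (x - 2)) * (1 / (x + 1)) := by
      field_simp; ring
    have e3 : y * (y - 1) / (x * (x - 1)) * (1 + (2 - z) / 2 * (4 / 5 * ((y - 2) / (y - 1)) *
        ((x - y) * (x - y - 1) / ((x - 1) * (x - 2))))) = y * (y - 1) / (x * (x - 1)) +
        (2 - z) / 2 * (4 / 5) * (y - 2) * y * ((x - y) * (x - y - 1)) /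
          (x * (x - 1) * (x - 2)) * (1 / (x - 1)) := by
      field_simp
    rw [e1, e2, e3]
    have : 1 / (x + 1) ≤ 1 / (x - 1) := by gcongr; linarith
    have := mul_le_mul_of_nonneg_left this hW
    linarith

/-! ### The competitive ratio -/

theorem le_mul_sum_pairBound_zero {m : ℕ} (hm : 6 ≤ m) :
    (m : ℝ) ≤ 3.77 * ∑ j ∈ Finset.Ico (m / 2) m, pairBound 0 (m / 2) j := by
  have hk : 3 ≤ m / 2 := by omega
  have h := sum_pairBound_ge (c := 0) (by norm_num) hk m (by omega)
  refine le_trans ?_ (mul_le_mul_of_nonneg_left h (by norm_num))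
  have hk' : (3 : ℝ) ≤ (m / 2 : ℕ) := by exact_mod_cast hk
  have hmk : m = 2 * (m / 2) ∨ m = 2 * (m / 2) + 1 := by omega
  generalize m / 2 = k at hk hk' hmk ⊢
  have h0 : 0 < (k : ℝ) := by linarith
  have h1 : 0 < 2 * (k : ℝ) - 1 := by linarith
  have h2 : 0 < (k : ℝ) - 1 := by linarith
  rcases hmk with rfl | rfl
  · push_cast
    have e : (k * (2 * k - k) / (2 * k - 1) + (2 - 0) / 2 * (4 / 5) * (k - 2) / 3 *
        ((2 * k - k) * (2 * k - k - 1) * (2 * k - k - 2) /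
          (2 * k * (2 * k - 1) * (2 * k - 2))) : ℝ) =
        (k ^ 2 + (k - 2) ^ 2 / 15) / (2 * k - 1) := by
      have : (2 * k - 2 : ℝ) = 2 * (k - 1) := by ring
      rw [this]
      field_simp
      ring
    rw [e, ← mul_div_assoc, le_div_iff₀ h1]
    nlinarith
  · push_cast
    have e : (k * (2 * k + 1 - k) / (2 * k + 1 - 1) + (2 - 0) / 2 * (4 / 5) * (k - 2) / 3 *
        ((2 * k + 1 - k) * (2 * k + 1 - k - 1) * (2 * k + 1 - k - 2) /
          ((2 * k + 1) * (2 * k + 1 - 1) * (2 * k + 1 - 2))) : ℝ) =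
        ((k + 1) * (4 * k ^ 2 - 1) / 2 + 4 / 5 * (k - 2) * (k ^ 2 - 1) / 6) /
          ((2 * k + 1) * (2 * k - 1)) := by
      have e1 : (2 * k + 1 - 2 : ℝ) = 2 * k - 1 := by ring
      have e2 : (2 * k + 1 - k : ℝ) = k + 1 := by ring
      have e3 : (k + 1 - 2 : ℝ) = k - 1 := by ring
      rw [e1, e2, e3, add_sub_cancel_right, add_sub_cancel_right]
      generalize hy : 2 * (k : ℝ) - 1 = y at h1
      have hk : (k : ℝ) = (y + 1) / 2 := by linarith
      have : y + 2 ≠ 0 := by linarith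
      have : y + 1 ≠ 0 := by linarith
      rw [hk]
      field_simp
      ring
    rw [e, ← mul_div_assoc, le_div_iff₀ (by positivity)]
    nlinarith [mul_pos h0 h2, mul_nonneg (mul_pos h0 h2).le (sub_nonneg.mpr hk')]

theorem le_mul_sum_pairBound_one {m : ℕ} (hm : 6 ≤ m) :
    (m : ℝ) ≤ 3.95 * ∑ j ∈ Finset.Ico (m / 2) m, pairBound 1 (m / 2) j := by
  have hk : 3 ≤ m / 2 := by omega
  have h := sum_pairBound_ge (c := 1) (by norm_num) hk m (by omega)
  refine le_trans ?_ (mul_le_mul_of_nonneg_left h (by norm_num))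
  have hk' : (3 : ℝ) ≤ (m / 2 : ℕ) := by exact_mod_cast hk
  have hmk : m = 2 * (m / 2) ∨ m = 2 * (m / 2) + 1 := by omega
  generalize m / 2 = k at hk hk' hmk ⊢
  have h0 : 0 < (k : ℝ) := by linarith
  have h1 : 0 < 2 * (k : ℝ) - 1 := by linarith
  have h2 : 0 < (k : ℝ) - 1 := by linarith
  rcases hmk with rfl | rfl
  · push_cast
    have e : (k * (2 * k - k) / (2 * k - 1) + (2 - 1) / 2 * (4 / 5) * (k - 2) / 3 *
        ((2 * k - k) * (2 * k - k - 1) * (2 * k - k - 2) /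
          (2 * k * (2 * k - 1) * (2 * k - 2))) : ℝ) =
        (k ^ 2 + (k - 2) ^ 2 / 30) / (2 * k - 1) := by
      have : (2 * k - 2 : ℝ) = 2 * (k - 1) := by ring
      rw [this]
      field_simp
      ring
    rw [e, ← mul_div_assoc, le_div_iff₀ h1]
    nlinarith
  · push_cast
    have e : (k * (2 * k + 1 - k) / (2 * k + 1 - 1) + (2 - 1) / 2 * (4 / 5) * (k - 2) / 3 *
        ((2 * k + 1 - k) * (2 * k + 1 - k - 1) * (2 * k + 1 - k - 2) /
          ((2 * k + 1) * (2 * k + 1 - 1) * (2 * k + 1 - 2))) : ℝ) =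
        ((k + 1) * (4 * k ^ 2 - 1) / 2 + 2 / 5 * (k - 2) * (k ^ 2 - 1) / 6) /
          ((2 * k + 1) * (2 * k - 1)) := by
      have e1 : (2 * k + 1 - 2 : ℝ) = 2 * k - 1 := by ring
      have e2 : (2 * k + 1 - k : ℝ) = k + 1 := by ring
      have e3 : (k + 1 - 2 : ℝ) = k - 1 := by ring
      rw [e1, e2, e3, add_sub_cancel_right, add_sub_cancel_right]
      generalize hy : 2 * (k : ℝ) - 1 = y at h1
      have hk : (k : ℝ) = (y + 1) / 2 := by linarith
      have : y + 2 ≠ 0 := by linarith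
      have : y + 1 ≠ 0 := by linarith
      rw [hk]
      field_simp
      ring
    rw [e, ← mul_div_assoc, le_div_iff₀ (by positivity)]
    nlinarith [mul_pos h0 h2, mul_nonneg (mul_pos h0 h2).le (sub_nonneg.mpr hk')]

/-- Lower bounds `N i` for the probability that two vertices `u` and `v` are unmarked after `i`
arrivals, if at most `c` edges between `u` and `v` ever lie in the forest, whose sum over all times
after the sample of `m / 2` edges is at least `m / α`. -/
def RatioBound (c m : ℕ) (α : ℝ) : Prop :=
  ∃ N : ℕ → ℝ, m ≤ α * ∑ j ∈ Finset.Ico (m / 2) m, N j ∧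
    ∀ (V : Type u) [Fintype V] [DecidableEq V] (u v : V) (S : Finset (Rec V)), u ≠ v →
      Proper (S : Set (Rec V)) → (∀ S' ⊆ S, (parallel S' u v).card ≤ c) →
        N S.card ≤ mean (m / 2) S.card S (unmarked {u, v})

theorem unmarked_empty {V : Type u} (A : Finset V) : unmarked A ∅ = 1 := by
  simp [unmarked]

/-- For `m ≤ 5`, where the finer bounds degenerate, the union bound suffices. -/
theorem ratioBound_of_le (c : ℕ) {m : ℕ} (hm : m ≤ 5) {α : ℝ} (hα : 3.75 ≤ α) :
    RatioBound.{u} c m α := by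
  rcases le_or_gt m 3 with h3 | h3
  · refine ⟨fun i => if i ≤ m / 2 then 1 else 0, ?_, ?_⟩
    · rcases Nat.eq_zero_or_pos m with rfl | h0
      · simp
      · have : (1 : ℝ) ≤ ∑ j ∈ Finset.Ico (m / 2) m, if j ≤ m / 2 then (1 : ℝ) else 0 := by
          have := Finset.single_le_sum (s := Finset.Ico (m / 2) m)
            (f := fun j => if j ≤ m / 2 then (1 : ℝ) else 0)
            (fun j _ => by split_ifs <;> norm_num)
            (Finset.mem_Ico.mpr ⟨le_rfl, by omega⟩ : m / 2 ∈ _)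
          simpa using this
        have h3' : (m : ℝ) ≤ 3 := by exact_mod_cast h3
        nlinarith
    · intro V _ _ u v S _ _ _
      dsimp only
      split_ifs with h
      · rw [mean_of_le h, unmarked_empty]
      · exact mean_nonneg (unmarked_nonneg _)
  · have hk : m / 2 = 2 := by omega
    refine ⟨fun i => if i ≤ 2 then 1 else 2 / (i * (i - 1)), ?_, ?_⟩
    · rw [hk]
      obtain rfl | rfl : m = 4 ∨ m = 5 := by omega
      · rw [Finset.sum_Ico_succ_top (by norm_num), Finset.sum_Ico_succ_top (by norm_num)]
        norm_num
        linarith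
      · rw [Finset.sum_Ico_succ_top (by norm_num), Finset.sum_Ico_succ_top (by norm_num),
          Finset.sum_Ico_succ_top (by norm_num)]
        norm_num
        linarith
    · intro V _ _ u v S _ hS _
      rw [hk]
      refine le_mean_unmarked (a := 2) (C := fun i => if i ≤ 2 then 1 else 2 / (i * (i - 1)))
        (fun i => ?_) (fun i hi => ?_) (fun i hi => ?_) S.card rfl hS Finset.card_le_two
      · split_ifs with h
        · exact zero_le_one
        · have : (3 : ℝ) ≤ i := by exact_mod_cast not_le.mp h
          exact div_nonneg zero_le_two (mul_nonneg (by linarith) (by linarith))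
      · rw [if_pos hi]
      · have hi' : (2 : ℝ) ≤ i := by exact_mod_cast hi
        have h1 : (i : ℝ) ≠ 0 := by linarith
        have h2 : (i : ℝ) - 1 ≠ 0 := by linarith
        have e : (if i ≤ 2 then (1 : ℝ) else 2 / (i * (i - 1))) = 2 / (i * (i - 1)) := by
          split_ifs with h
          · obtain rfl : i = 2 := by omega
            norm_num
          · rfl
        rw [e, if_neg (by omega)]
        push_cast
        rw [add_sub_cancel_right]
        apply le_of_eq
        field_simp
        ring

theorem ratioBound_of_sum {c m : ℕ} (hc : c ≤ 1) (hm : 6 ≤ m) {α : ℝ}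
    (h : m ≤ α * ∑ j ∈ Finset.Ico (m / 2) m, pairBound c (m / 2) j) : RatioBound.{u} c m α := by
  have hk : 3 ≤ m / 2 := by omega
  refine ⟨pairBound c (m / 2), h, fun V _ _ u v S huv hS hpar => ?_⟩
  refine le_mean_unmarked_pair hc huv (P := markedBound (m / 2)) ?_ (markedBound_nonneg hk)
    (markedBound_le_pairBound hc hk) pairBound_le_one (pairBound_succ hk) S.card rfl hS hpar
  intro i S hi hS x hx
  exact le_mean_unmarkedMarked (twoBound_nonneg hk) twoBound_le_one (twoBound_succ hk)
    (threeBound_nonneg hk) threeBound_le_one (threeBound_succ hk) (markedBound_nonneg hk)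
    (markedBound_eq_zero hk) (markedBound_succ_root hk) (markedBound_succ_head hk) i hi hS
    (Finset.card_pair huv) hx

theorem ratioBound_zero (m : ℕ) : RatioBound.{u} 0 m 3.77 := by
  rcases le_or_gt m 5 with h | h
  · exact ratioBound_of_le 0 h (by norm_num)
  · exact ratioBound_of_sum zero_le_one h (by exact_mod_cast le_mul_sum_pairBound_zero h)

theorem ratioBound_one (m : ℕ) : RatioBound.{u} 1 m 3.95 := by
  rcases le_or_gt m 5 with h | h
  · exact ratioBound_of_le 1 h (by norm_num)
  · exact ratioBound_of_sum le_rfl h (by exact_mod_cast le_mul_sum_pairBound_one h)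

/-! ### The run of the algorithm -/

open scoped Classical in
/-- The first `j` of the arriving records `ρ`. -/
noncomputable def seen {V : Type u} {m : ℕ} (ρ : Fin m → Rec V) (j : ℕ) : Finset (Rec V) :=
  (Finset.univ.filter fun s : Fin m => (s : ℕ) < j).image ρ

/-- The vertices marked after `j` arrivals, of which the first `k` are only observed; `b t` are the
coins tossed at time `t`. -/
noncomputable def state {V : Type u} [Fintype V] {m : ℕ} (k : ℕ) (ρ : Fin m → Rec V)
    (b : Fin m → Fin (Fintype.card V) → Bool) : ℕ → Set V
  | 0 => ∅
  | j + 1 =>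
    if h : k ≤ j ∧ j < m then
      step (seen ρ (j + 1)) (ρ ⟨j, h.2⟩) (drawn (b ⟨j, h.2⟩)) (state k ρ b j)
    else state k ρ b j

/-- The edge of time `t` is accepted. -/
def Accepts {V : Type u} [Fintype V] {m : ℕ} (k : ℕ) (ρ : Fin m → Rec V)
    (b : Fin m → Fin (Fintype.card V) → Bool) (t : Fin m) : Prop :=
  k ≤ t ∧ ∃ x y, Heads (greedy (seen ρ (t + 1) : Set (Rec V))) (ρ t) x y ∧
    x ∉ state k ρ b t ∧ y ∉ state k ρ b t

theorem mem_seen {V : Type u} {m : ℕ} {ρ : Fin m → Rec V} {j : ℕ} {r : Rec V} :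
    r ∈ seen ρ j ↔ ∃ s : Fin m, (s : ℕ) < j ∧ ρ s = r := by
  simp [seen]

theorem seen_congr {V : Type u} {m : ℕ} {ρ ρ' : Fin m → Rec V} {j : ℕ}
    (h : ∀ s : Fin m, (s : ℕ) < j → ρ s = ρ' s) : seen ρ j = seen ρ' j := by
  ext r
  simp only [mem_seen]
  exact exists_congr fun s => and_congr_right fun hs => by rw [h s hs]

theorem state_congr {V : Type u} [Fintype V] {m k : ℕ} {ρ ρ' : Fin m → Rec V}
    {b b' : Fin m → Fin (Fintype.card V) → Bool} {j : ℕ}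
    (h : ∀ s : Fin m, (s : ℕ) < j → ρ s = ρ' s) (hb : ∀ s : Fin m, (s : ℕ) < j → b s = b' s) :
    state k ρ b j = state k ρ' b' j := by
  induction j with
  | zero => rfl
  | succ j ih =>
    have ih := ih (fun s hs => h s (hs.trans (Nat.lt_succ_self j)))
      (fun s hs => hb s (hs.trans (Nat.lt_succ_self j)))
    rw [state, state]
    split_ifs with hj
    · rw [ih, seen_congr h, h ⟨j, hj.2⟩ (Nat.lt_succ_self j), hb ⟨j, hj.2⟩ (Nat.lt_succ_self j)]
    · exact ih

theorem Accepts.congr {V : Type u} [Fintype V] {m k : ℕ} {ρ ρ' : Fin m → Rec V}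
    {b : Fin m → Fin (Fintype.card V) → Bool} {t : Fin m} (h : ∀ s ≤ t, ρ s = ρ' s) :
    Accepts k ρ b t ↔ Accepts k ρ' b t := by
  rw [Accepts, Accepts, h t le_rfl,
    seen_congr fun s hs => h s (Fin.le_def.mpr (Nat.lt_succ_iff.mp hs)),
    state_congr (fun s hs => h s (Fin.le_def.mpr hs.le)) fun _ _ => rfl]

theorem state_of_le {V : Type u} [Fintype V] {m k : ℕ} (ρ : Fin m → Rec V)
    (b : Fin m → Fin (Fintype.card V) → Bool) {j : ℕ} (h : j ≤ k) : state k ρ b j = ∅ := by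
  induction j with
  | zero => rfl
  | succ j ih => rw [state, dif_neg (by omega), ih (by omega)]

/-- The probability of a sequence of coin tosses. -/
noncomputable def tossProb {ι : Type} [Fintype ι] {m : ℕ} (b : Fin m → ι → Bool) : ℝ :=
  ∏ t : Fin m, coinProb (4 / 5 / (t + 1 : ℕ)) (b t)

theorem tossProb_nonneg {ι : Type} [Fintype ι] {m : ℕ} (b : Fin m → ι → Bool) : 0 ≤ tossProb b :=
  Finset.prod_nonneg fun t _ => coinProb_nonneg (bias_nonneg t) (bias_le_one t) _

theorem sum_tossProb (ι : Type) [Fintype ι] [DecidableEq ι] (m : ℕ) :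
    ∑ b : Fin m → ι → Bool, tossProb b = 1 := by
  have := Finset.prod_univ_sum (fun _ : Fin m => (Finset.univ : Finset (ι → Bool)))
    (fun t c => coinProb (4 / 5 / (t + 1 : ℕ)) c)
  rw [Fintype.piFinset_univ] at this
  simp only [tossProb]
  rw [← this]
  exact Finset.prod_eq_one fun t _ => sum_coinProb _

/-- The coins of time `t` may be tossed again. -/
theorem sum_tossProb_resample {ι : Type} [Fintype ι] [DecidableEq ι] {m : ℕ} (t : Fin m)
    (f : (Fin m → ι → Bool) → (ι → Bool) → ℝ)
    (hf : ∀ b b', (∀ s ≠ t, b s = b' s) → f b = f b') :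
    ∑ b, tossProb b * f b (b t) =
      ∑ b, tossProb b * ∑ c, coinProb (4 / 5 / (t + 1 : ℕ)) c * f b c := by
  obtain ⟨b₀⟩ : Nonempty (Fin m → ι → Bool) := inferInstance
  have hp : ∀ b : Fin m → ι → Bool, tossProb b = coinProb (4 / 5 / (t + 1 : ℕ)) (b t) *
      ∏ s : {s // s ≠ t}, coinProb (4 / 5 / ((s : Fin m) + 1 : ℕ)) (b s) := by
    intro b
    rw [tossProb, Fintype.prod_eq_mul_prod_subtype_ne _ t]
  have split : ∀ F : (Fin m → ι → Bool) → ℝ, ∑ b, F b =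
      ∑ c : ι → Bool, ∑ r : {s // s ≠ t} → ι → Bool, F ((Equiv.funSplitAt t _).symm (c, r)) := by
    intro F
    rw [← Fintype.sum_prod_type', ← (Equiv.funSplitAt t (ι → Bool)).symm.sum_comp]
  have e1 : ∀ (c : ι → Bool) (r : {s // s ≠ t} → ι → Bool),
      ((Equiv.funSplitAt t _).symm (c, r) : Fin m → ι → Bool) t = c := fun c r => by simp
  have e2 : ∀ (c : ι → Bool) (r : {s // s ≠ t} → ι → Bool) (s : {s // s ≠ t}),
      ((Equiv.funSplitAt t _).symm (c, r) : Fin m → ι → Bool) s = r s := fun c r s => by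
    simp [s.2]
  have e3 : ∀ (c c' : ι → Bool) (r : {s // s ≠ t} → ι → Bool),
      f ((Equiv.funSplitAt t _).symm (c, r)) = f ((Equiv.funSplitAt t _).symm (c', r)) :=
    fun c c' r => hf _ _ fun s hs => by
      have := e2 c r ⟨s, hs⟩
      have := e2 c' r ⟨s, hs⟩
      simp_all
  rw [split, split]
  simp only [hp, e1, e2]
  rw [Finset.sum_comm, Finset.sum_comm (s := Finset.univ (α := ι → Bool))]
  refine Finset.sum_congr rfl fun r _ => ?_
  have e4 : ∀ c : ι → Bool, f ((Equiv.funSplitAt t _).symm (c, r)) =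
      f ((Equiv.funSplitAt t _).symm (b₀ t, r)) := fun c => e3 c _ r
  simp only [e4]
  simp only [mul_assoc]
  rw [← Finset.sum_mul, sum_coinProb, one_mul, Finset.mul_sum]
  exact Finset.sum_congr rfl fun c _ => by ring

theorem seen_perm {V : Type u} {E : Type v} {m : ℕ} (r : E → Rec V) (σ : Fin m ≃ E)
    {π : Equiv.Perm (Fin m)} {j : ℕ} (hπ : ∀ t : Fin m, j ≤ t → π t = t) :
    seen (fun t => r (π.trans σ t)) j = seen (fun t => r (σ t)) j := by
  have hlt : ∀ t : Fin m, (t : ℕ) < j ↔ (π t : ℕ) < j := by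
    intro t
    constructor
    · intro h
      by_contra h'
      have := π.injective (hπ (π t) (not_lt.mp h'))
      rw [this] at h'
      exact h' h
    · intro h
      by_contra h'
      rw [hπ t (not_lt.mp h')] at h
      exact h' h
  ext x
  simp only [mem_seen, Equiv.trans_apply]
  constructor
  · rintro ⟨s, hs, e⟩
    exact ⟨π s, (hlt s).mp hs, e⟩
  · rintro ⟨s, hs, e⟩
    exact ⟨π.symm s, (hlt _).mpr (by simpa using hs), by simpa using e⟩

/-- The run over a uniformly random order has the recursively defined expectations: given the set of
the first `j` edges, the last one of them is uniform. -/
theorem sum_state_eq_sum_mean {V : Type u} [Fintype V] {E : Type v} [Fintype E] [DecidableEq E]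
    {m k : ℕ} {r : E → Rec V} (hr : Function.Injective r) (j : ℕ) (hj : j ≤ m)
    (Φ : (Fin m ≃ E) → Set V → ℝ)
    (hΦ : ∀ (σ : Fin m ≃ E) (π : Equiv.Perm (Fin m)), (∀ t : Fin m, j ≤ t → π t = t) →
      Φ (π.trans σ) = Φ σ) :
    ∑ σ : Fin m ≃ E, ∑ b : Fin m → Fin (Fintype.card V) → Bool,
        tossProb b * Φ σ (state k (fun t => r (σ t)) b j) =
      ∑ σ : Fin m ≃ E, mean k j (seen (fun t => r (σ t)) j) (Φ σ) := by
  classical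
  rcases le_or_gt j k with hjk | hjk
  · refine Finset.sum_congr rfl fun σ _ => ?_
    simp only [state_of_le _ _ hjk, mean_of_le hjk, ← Finset.sum_mul, sum_tossProb, one_mul]
  induction j generalizing Φ with
  | zero => omega
  | succ j ih =>
    have hk : k ≤ j := Nat.lt_succ_iff.mp hjk
    have hjm : j < m := hj
    set T : Fin m := ⟨j, hjm⟩ with hT
    set S : (Fin m ≃ E) → Finset (Rec V) := fun σ => seen (fun t => r (σ t)) (j + 1) with hSdef
    set d : ℝ := 4 / 5 / (j + 1 : ℕ) with hd
    have hS : ∀ (σ : Fin m ≃ E) (π : Equiv.Perm (Fin m)),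
        (∀ t : Fin m, j + 1 ≤ t → π t = t) → S (π.trans σ) = S σ := fun σ π h =>
      seen_perm r σ h
    have hdel : ∀ σ : Fin m ≃ E, seen (fun t => r (σ t)) j = del (S σ) (r (σ T)) := by
      intro σ
      ext x
      simp only [del, hSdef, Finset.mem_erase, mem_seen]
      constructor
      · rintro ⟨s, hs, rfl⟩
        refine ⟨fun h => ?_, s, by omega, rfl⟩
        have := σ.injective (hr h)
        rw [this] at hs
        exact lt_irrefl _ hs
      · rintro ⟨hne, s, hs, rfl⟩
        refine ⟨s, lt_of_le_of_ne (Nat.lt_succ_iff.mp hs) fun h => hne ?_, rfl⟩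
        rw [show s = T from Fin.ext h]
    set F : (Fin m ≃ E) → Rec V → ℝ := fun σ g =>
      mean k j (del (S σ) g) (stepMean d (S σ) g (Φ σ)) with hF
    have hFinv : ∀ (σ : Fin m ≃ E) (π : Equiv.Perm (Fin m)),
        (∀ t : Fin m, j + 1 ≤ t → π t = t) → F (π.trans σ) = F σ := by
      intro σ π h
      simp only [hF, hS σ π h, hΦ σ π h]
    have lhs : ∑ σ : Fin m ≃ E, ∑ b : Fin m → Fin (Fintype.card V) → Bool,
        tossProb b * Φ σ (state k (fun t => r (σ t)) b (j + 1)) =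
        ∑ σ : Fin m ≃ E, F σ (r (σ T)) := by
      have := ih hjm.le (fun σ => stepMean d (S σ) (r (σ T)) (Φ σ)) (fun σ π h => by
        have h' : ∀ t : Fin m, j + 1 ≤ t → π t = t := fun t ht => h t (by omega)
        simp only [hS σ π h', hΦ σ π h', Equiv.trans_apply, h T le_rfl])
      have ih' : ∑ σ : Fin m ≃ E, ∑ b : Fin m → Fin (Fintype.card V) → Bool,
          tossProb b * stepMean d (S σ) (r (σ T)) (Φ σ) (state k (fun t => r (σ t)) b j) =
          ∑ σ : Fin m ≃ E, mean k j (seen (fun t => r (σ t)) j)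
            (stepMean d (S σ) (r (σ T)) (Φ σ)) := by
        rcases hk.eq_or_lt with rfl | hlt
        · refine Finset.sum_congr rfl fun σ _ => ?_
          simp only [state_of_le _ _ le_rfl, mean_of_le le_rfl, ← Finset.sum_mul, sum_tossProb,
            one_mul]
        · exact this hlt
      simp only [hdel] at ih'
      rw [← ih']
      refine Finset.sum_congr rfl fun σ _ => ?_
      have e : ∀ b : Fin m → Fin (Fintype.card V) → Bool, state k (fun t => r (σ t)) b (j + 1) =
          step (S σ) (r (σ T)) (drawn (b T)) (state k (fun t => r (σ t)) b j) := fun b => by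
        rw [state, dif_pos ⟨hk, hjm⟩]
      simp only [e]
      exact sum_tossProb_resample T (fun b c => Φ σ (step (S σ) (r (σ T)) (drawn c)
        (state k (fun t => r (σ t)) b j))) fun b b' h => by
          funext c
          have : state k (fun t => r (σ t)) b j = state k (fun t => r (σ t)) b' j :=
            state_congr (fun _ _ => rfl) fun s hs => h s fun hsT => by
              rw [hsT] at hs; exact lt_irrefl _ hs
          simp only [this]
    -- exchanging the positions `i` and `j` makes the edge of position `i` the last one
    have swap : ∀ i : Fin m, (i : ℕ) < j + 1 →
        ∑ σ : Fin m ≃ E, F σ (r (σ i)) = ∑ σ : Fin m ≃ E, F σ (r (σ T)) := by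
      intro i hi
      rw [← (Equiv.equivCongr (Equiv.swap i T) (Equiv.refl E)).sum_comp
        (fun σ : Fin m ≃ E => F σ (r (σ T)))]
      refine Finset.sum_congr rfl fun σ _ => ?_
      have e : (Equiv.equivCongr (Equiv.swap i T) (Equiv.refl E)) σ =
          (Equiv.swap i T).trans σ := by
        ext x; simp [Equiv.equivCongr]
      rw [e, hFinv σ (Equiv.swap i T) fun t ht => Equiv.swap_apply_of_ne_of_ne
        (fun h => by rw [h] at ht; omega) (fun h => by rw [h] at ht; simp [T] at ht)]
      simp
    rw [lhs]
    have rhs : ∀ σ : Fin m ≃ E, mean k (j + 1) (S σ) (Φ σ) =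
        (∑ i ∈ Finset.univ.filter fun i : Fin m => (i : ℕ) < j + 1, F σ (r (σ i))) /
          (j + 1 : ℕ) := by
      intro σ
      rw [mean_succ hk]
      congr 1
      change ∑ g ∈ S σ, F σ g = _
      simp only [hSdef, seen]
      rw [Finset.sum_image fun s _ s' _ h => σ.injective (hr h)]
    rw [Finset.sum_congr rfl fun σ _ => rhs σ, ← Finset.sum_div, Finset.sum_comm,
      Finset.sum_congr rfl fun i hi => swap i (Finset.mem_filter.mp hi).2, Finset.sum_const]
    have hcard : (Finset.univ.filter fun i : Fin m => (i : ℕ) < j + 1).card = j + 1 := by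
      rw [Fin.card_filter_val_lt]; omega
    rw [hcard, nsmul_eq_mul, mul_div_cancel_left₀]
    positivity

/-! ### Acceptances form a forest -/

theorem state_mono {V : Type u} [Fintype V] {m : ℕ} (k : ℕ) (ρ : Fin m → Rec V)
    (b : Fin m → Fin (Fintype.card V) → Bool) : Monotone (state k ρ b) := by
  refine monotone_nat_of_le_succ fun j => ?_
  rw [state]
  split_ifs
  · exact fun y hy => Or.inl (Or.inl hy)
  · exact le_rfl

theorem head_mem_state {V : Type u} [Fintype V] {m k : ℕ} {ρ : Fin m → Rec V}
    {b : Fin m → Fin (Fintype.card V) → Bool} {t : Fin m} (hk : k ≤ t) {x y : V}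
    (h : Heads (greedy (seen ρ (t + 1) : Set (Rec V))) (ρ t) x y)
    (hx : x ∉ state k ρ b t) (hy : y ∉ state k ρ b t) : y ∈ state k ρ b (t + 1) := by
  rw [state, dif_pos ⟨hk, t.2⟩]
  exact Or.inl (Or.inr ⟨x, h, hx, hy⟩)

/-- On a cycle of accepted edges, no edge contains the head of an earlier one. So distinct edges
have distinct heads, every vertex of the cycle is a head, and both ends of the last edge to arrive
are heads; but one of them is the head of an earlier edge. -/
theorem exists_not_accepts {V : Type u} [Fintype V] {m k : ℕ} {ρ : Fin m → Rec V}
    {b : Fin m → Fin (Fintype.card V) → Bool} {n : ℕ} {x : Fin (n + 2) → V}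
    {t : Fin (n + 2) → Fin m} (ht : Function.Injective t)
    (hlink : ∀ i, (ρ (t i)).1 = {x i, x (i + 1)}) : ∃ i, ¬ Accepts k ρ b (t i) := by
  by_contra! hacc
  have hhead : ∀ i, ∃ j, (j = i ∨ j = i + 1) ∧ x j ∈ state k ρ b (t i + 1) := by
    intro i
    obtain ⟨hk, a, y, h, ha, hy⟩ := hacc i
    have hmem := head_mem_state hk h ha hy
    have e := h.2.1
    rw [hlink i] at e
    rcases pair_eq_cases e with ⟨_, rfl⟩ | ⟨rfl, _⟩
    · exact ⟨_, Or.inr rfl, hmem⟩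
    · exact ⟨_, Or.inl rfl, hmem⟩
  have hends : ∀ i j, (j = i ∨ j = i + 1) → x j ∉ state k ρ b (t i) := by
    intro i j hj
    obtain ⟨_, a, y, h, ha, hy⟩ := hacc i
    have e := h.2.1
    rw [hlink i] at e
    rcases pair_eq_cases e with ⟨h1, h2⟩ | ⟨h1, h2⟩
    · rcases hj with rfl | rfl
      · rwa [h1]
      · rwa [h2]
    · rcases hj with rfl | rfl
      · rwa [h1]
      · rwa [h2]
  choose hd hdi hds using hhead
  have hlater : ∀ i i', t i < t i' → ¬ (hd i = i' ∨ hd i = i' + 1) := fun i i' hlt h =>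
    hends i' _ h (state_mono k ρ b (Nat.succ_le_of_lt (Fin.lt_def.mp hlt)) (hds i))
  have hinj : Function.Injective hd := by
    intro i i' h
    by_contra hne
    rcases lt_or_gt_of_ne fun h => hne (ht h) with hlt | hlt
    · exact hlater i i' hlt (h ▸ hdi i')
    · exact hlater i' i hlt (h ▸ hdi i)
  have hsurj := Finite.surjective_of_injective hinj
  obtain ⟨l, -, hl⟩ := Finset.exists_max_image Finset.univ t Finset.univ_nonempty
  have hlt : ∀ i, i ≠ l → t i < t l := fun i hi =>
    lt_of_le_of_ne (hl i (Finset.mem_univ i)) fun h => hi (ht h)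
  obtain ⟨i, hi⟩ := hsurj l
  obtain ⟨i', hi'⟩ := hsurj (l + 1)
  rcases eq_or_ne i l with rfl | hne
  · have hne : i' ≠ i := by
      rintro rfl
      have : i' = i' + 1 := hi.symm.trans hi'
      simp at this
    exact hlater i' i (hlt _ hne) (Or.inr hi')
  · exact hlater i l (hlt _ hne) (Or.inl hi)

/-! ### Optimality of the greedy forest -/

theorem IsForest.mono {V : Type u} {T T' : Set (Rec V)} (h : IsForest T') (hT : T ⊆ T') :
    IsForest T := fun g hg a b e hc =>
  h g (hT hg) a b e (hc.mono (Set.sdiff_subset_sdiff_left hT))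

theorem exists_walk_of_conn {V : Type u} {T : Set (Rec V)} (H : SimpleGraph V)
    (hH : ∀ x y, JoinedBy T x y → x ≠ y → H.Adj x y) {a b : V} (h : Conn T a b) :
    H.Reachable a b := by
  induction h with
  | refl => exact SimpleGraph.Reachable.refl _
  | @tail c d _ hcd ih =>
    rcases eq_or_ne c d with rfl | hne
    · exact ih
    · exact ih.trans (hH c d hcd hne).reachable

/-- An independent set of edges is the edge set of a forest. A path joining the endpoints of one of
its edges and avoiding this edge would close a cycle. -/
theorem Indep.isForest {V : Type u} {E : Type v} {G : Graph V E} {r : E → Rec V}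
    (hlink : ∀ e a b, G.IsLink e a b ↔ (r e).1 = {a, b})
    (hne : ∀ e a b, G.IsLink e a b → a ≠ b) {I : Finset E} (hI : Indep G I) :
    IsForest (r '' I) := by
  classical
  rintro _ ⟨e, he, rfl⟩ a b hab hconn
  set T := r '' I \ {r e} with hT
  let H : SimpleGraph V := SimpleGraph.fromRel (JoinedBy T)
  obtain ⟨p, hp⟩ := (exists_walk_of_conn H (fun x y h hxy =>
    (SimpleGraph.fromRel_adj _ _ _).mpr ⟨hxy, Or.inl h⟩) hconn).exists_isPath
  have hadj : ∀ x y, H.Adj x y → JoinedBy T x y := fun x y h =>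
    ((SimpleGraph.fromRel_adj _ _ _).mp h).2.elim id JoinedBy.symm
  have hlen : p.length ≠ 0 := fun h => hne e a b ((hlink e a b).mpr hab)
    (SimpleGraph.Walk.eq_of_length_eq_zero h)
  obtain ⟨k, hk⟩ := Nat.exists_eq_succ_of_ne_zero hlen
  have hedge : ∀ i, i < p.length → ∃ f ∈ I, f ≠ e ∧
      (r f).1 = {p.getVert i, p.getVert (i + 1)} := by
    intro i hi
    obtain ⟨_, ⟨⟨f, hf, rfl⟩, hfe⟩, h⟩ := hadj _ _ (p.adj_getVert_succ hi)
    exact ⟨f, hf, fun h' => hfe (by rw [h']; rfl), h⟩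
  have : Nonempty E := ⟨e⟩
  choose! c hcI hce hc using hedge
  have hx : Function.Injective fun i : Fin (k + 2) => p.getVert i := fun i j h =>
    Fin.ext (hp.getVert_injOn (by simp only [Set.mem_ofPred_eq]; omega)
      (by simp only [Set.mem_ofPred_eq]; omega) h)
  have hidx : ∀ i j : ℕ, i ≤ p.length → j ≤ p.length → p.getVert i = p.getVert j → i = j :=
    fun i j hi hj h => hp.getVert_injOn hi hj h
  have hinj : Function.Injective fun i : Fin (k + 2) => if (i : ℕ) < p.length then c i else e := by
    intro i j hij
    dsimp only at hij
    split_ifs at hij with h h' h'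
    · have e1 := hc i h
      rw [hij, hc j h'] at e1
      rcases pair_eq_cases e1 with ⟨h1, _⟩ | ⟨h1, h2⟩
      · exact (Fin.ext (hidx _ _ h'.le h.le h1)).symm
      · have := hidx _ _ h'.le h h1
        have := hidx _ _ h' h.le h2
        omega
    · exact absurd hij (hce _ h)
    · exact absurd hij.symm (hce _ h')
    · exact Fin.ext (by omega)
  have hcycle : ∀ i : Fin (k + 2), G.IsLink (if (i : ℕ) < p.length then c i else e)
      (p.getVert i) (p.getVert (i + 1 : Fin (k + 2))) := by
    intro i
    rw [hlink]
    split_ifs with h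
    · rw [hc _ h, Fin.val_add_one, if_neg]
      intro hl
      rw [hl] at h
      simp at h
      omega
    · obtain rfl : i = Fin.last (k + 1) := Fin.ext (by simp; omega)
      have : ((Fin.last (k + 1) : Fin (k + 2)) : ℕ) = p.length := by simp; omega
      rw [Fin.last_add_one, this, p.getVert_length, Fin.val_zero, p.getVert_zero, hab,
        Set.pair_comm]
  obtain ⟨i, hi⟩ := hI k _ _ hx hinj hcycle
  split_ifs at hi with h
  · exact hi (hcI _ h)
  · exact hi he

/-- If at every positive level `F` has at least as many elements as `I`, then its weight is at least
that of `I`: compare the heaviest elements, and delete them. -/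
theorem sum_le_sum_of_card_filter_le {E : Type v} [DecidableEq E] {w : E → ℝ} {I F : Finset E}
    (hF : ∀ e ∈ F, 0 < w e)
    (h : ∀ x : ℝ, 0 < x → (I.filter fun e => x ≤ w e).card ≤ (F.filter fun e => x ≤ w e).card) :
    ∑ e ∈ I, w e ≤ ∑ e ∈ F, w e := by
  induction I using Finset.induction_on_max_value (f := w) generalizing F with
  | empty => exact Finset.sum_nonneg fun e he => (hF e he).le
  | insert e I he hmax ih =>
    rcases le_or_gt (w e) 0 with h0 | h0
    · refine le_trans ?_ (Finset.sum_nonneg fun e he => (hF e he).le)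
      refine Finset.sum_nonpos fun f hf => ?_
      rcases Finset.mem_insert.mp hf with rfl | hf
      · exact h0
      · exact (hmax f hf).trans h0
    have hne : (F.filter fun f => w e ≤ w f).Nonempty := by
      rw [← Finset.card_pos]
      exact (Finset.card_pos.mpr ⟨e, by simp⟩).trans_le (h (w e) h0)
    obtain ⟨f, hf⟩ := hne
    obtain ⟨hf, hef⟩ := Finset.mem_filter.mp hf
    rw [Finset.sum_insert he, ← Finset.add_sum_erase F w hf]
    refine add_le_add hef (ih (fun g hg => hF g (Finset.mem_of_mem_erase hg)) fun x hx => ?_)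
    rcases le_or_gt x (w e) with hxe | hxe
    · have := h x hx
      rw [Finset.filter_insert, if_pos hxe, Finset.card_insert_of_notMem
        (fun h => he (Finset.mem_filter.mp h).1)] at this
      rw [Finset.filter_erase, Finset.card_erase_of_mem
        (Finset.mem_filter.mpr ⟨hf, hxe.trans hef⟩)]
      omega
    · rw [Finset.filter_false_of_mem fun g hg => not_le.mpr ((hmax g hg).trans_lt hxe)]
      simp

open scoped Classical in
/-- The edges whose records form the greedy forest. -/
noncomputable def optimalForest {V : Type u} {E : Type v} [Fintype E] (r : E → Rec V) : Finset E :=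
  Finset.univ.filter fun e => r e ∈ greedy (Finset.univ.image r : Set (Rec V))

theorem opt_le_sum_optimalForest {V : Type u} [Fintype V] {E : Type v} [Fintype E] {G : Graph V E}
    {w : E → ℝ} {r : E → Rec V} (hr : Function.Injective r)
    (hlink : ∀ e a b, G.IsLink e a b ↔ (r e).1 = {a, b}) (hw : ∀ e, (r e).2.1 = w e)
    (hP : Proper (Set.range r)) : opt G w ≤ ∑ e ∈ optimalForest r, w e := by
  classical
  have hne : ∀ e a b, G.IsLink e a b → a ≠ b := by
    rintro e a _ h rfl
    obtain ⟨c, d, hcd, e'⟩ := hP.pair (r e) ⟨e, rfl⟩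
    rw [(hlink e a a).mp h] at e'
    rcases pair_eq_cases e' with ⟨rfl, rfl⟩ | ⟨rfl, rfl⟩ <;> exact hcd rfl
  refine Finset.sup'_le _ _ fun I hI => ?_
  have hI := (Finset.mem_filter.mp hI).2
  refine sum_le_sum_of_card_filter_le (fun e he => hw e ▸ (Finset.mem_filter.mp he).2.2.1)
    fun x hx => ?_
  set T : Finset (Rec V) := (I.filter fun e => x ≤ w e).image r with hT
  set T' : Finset (Rec V) := ((optimalForest r).filter fun e => x ≤ w e).image r with hT'
  rw [← Finset.card_image_of_injective _ hr, ← Finset.card_image_of_injective _ hr]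
  have hforest : IsForest (T : Set (Rec V)) := by
    refine (hI.isForest hlink hne).mono ?_
    rw [hT, Finset.coe_image]
    exact Set.image_mono (Finset.coe_subset.mpr (Finset.filter_subset _ _))
  have hpair : ∀ g ∈ T, ∃ a b : V, g.1 = {a, b} := by
    intro g hg
    obtain ⟨e, _, rfl⟩ := Finset.mem_image.mp hg
    obtain ⟨a, b, _, h⟩ := hP.pair (r e) ⟨e, rfl⟩
    exact ⟨a, b, h⟩
  have hT'eq : (T' : Set (Rec V)) =
      {f | f ∈ greedy ((Finset.univ.image r : Finset (Rec V)) : Set (Rec V)) ∧ x ≤ f.2.1} := by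
    ext f
    simp only [hT', optimalForest, Finset.coe_image, Set.mem_image, Finset.mem_coe,
      Finset.mem_filter, Set.mem_ofPred_eq, Finset.mem_univ, true_and]
    constructor
    · rintro ⟨e, ⟨h1, h2⟩, rfl⟩
      exact ⟨by simpa using h1, by rw [hw]; exact h2⟩
    · rintro ⟨h1, h2⟩
      obtain ⟨e, rfl⟩ := (by simpa using h1.1 : ∃ e, r e = f)
      exact ⟨e, ⟨by simpa using h1, by rw [← hw]; exact h2⟩, rfl⟩
  have hsub : NonLeast (T : Set (Rec V)) ⊆ NonLeast (T' : Set (Rec V)) := by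
    rintro y ⟨y', hy, hlt⟩
    refine ⟨y', Conn.of_forall ?_ hy, hlt⟩
    intro g hg a b e
    obtain ⟨f, hf, rfl⟩ := Finset.mem_image.mp (Finset.mem_coe.mp hg)
    rw [hT'eq]
    refine conn_greedy (r := r f) hx (Finset.mem_image_of_mem r (Finset.mem_univ f)) ?_ e
    rw [hw]; exact (Finset.mem_filter.mp hf).2
  exact (hforest.card_le hpair).trans
    ((Set.ncard_le_ncard hsub (Set.toFinite _)).trans (ncard_nonLeast_le T'))

/-! ### The expected weight -/

theorem card_mul_card_filter_apply_eq {E : Type v} [Fintype E] [DecidableEq E] {m : ℕ}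
    (hm : Fintype.card E = m) (t : Fin m) (e : E) :
    m * (Finset.univ.filter fun σ : Fin m ≃ E => σ t = e).card = m.factorial := by
  have h1 : ∀ f, (Finset.univ.filter fun σ : Fin m ≃ E => σ t = f).card =
      (Finset.univ.filter fun σ : Fin m ≃ E => σ t = e).card := by
    intro f
    refine Finset.card_bij' (fun σ _ => σ.trans (Equiv.swap e f))
      (fun σ _ => σ.trans (Equiv.swap e f)) ?_ ?_ ?_ ?_
    · intro σ h
      have := (Finset.mem_filter.mp h).2
      simp [this]
    · intro σ h
      have := (Finset.mem_filter.mp h).2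
      simp [this]
    · intro σ _
      ext; simp
    · intro σ _
      ext; simp
  have h2 := Finset.card_eq_sum_card_fiberwise (f := fun σ : Fin m ≃ E => σ t)
    (s := Finset.univ) (t := Finset.univ) fun _ _ => Finset.mem_coe.mpr (Finset.mem_univ _)
  rw [Finset.sum_congr rfl fun f _ => h1 f, Finset.sum_const, Finset.card_univ, Finset.card_univ,
    hm, smul_eq_mul, Fintype.card_equiv (Fintype.equivFinOfCardEq hm).symm, Fintype.card_fin] at h2
  exact h2.symm

theorem seen_subset {V : Type u} {E : Type v} [DecidableEq E] [DecidableEq (Rec V)] [Fintype E]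
    {m : ℕ} (r : E → Rec V) (σ : Fin m ≃ E) (t : Fin m) :
    seen (fun s => r (σ s)) t ⊆ (Finset.univ.erase (σ t)).image r := by
  intro x hx
  obtain ⟨s, hs, rfl⟩ := mem_seen.mp hx
  refine Finset.mem_image_of_mem r (Finset.mem_erase.mpr ⟨fun h => ?_, Finset.mem_univ _⟩)
  rw [σ.injective h] at hs
  exact lt_irrefl _ hs

theorem card_seen {V : Type u} {E : Type v} {m : ℕ} {r : E → Rec V} (hr : Function.Injective r)
    (σ : Fin m ≃ E) (t : Fin m) : (seen (fun s => r (σ s)) t).card = t := by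
  classical
  rw [seen, Finset.card_image_of_injective _ (fun s s' h => σ.injective (hr h)),
    Fin.card_filter_val_lt]
  exact min_eq_right t.2.le

theorem proper_seen {V : Type u} {E : Type v} {m : ℕ} {r : E → Rec V}
    (hP : Proper (Set.range r)) (ρ : Fin m → E) (j : ℕ) :
    Proper (seen (fun s => r (ρ s)) j : Set (Rec V)) := by
  refine hP.mono fun x hx => ?_
  obtain ⟨s, _, rfl⟩ := mem_seen.mp (Finset.mem_coe.mp hx)
  exact ⟨_, rfl⟩

open scoped Classical in
/-- Given the order and the coins, an edge `e` of the optimal forest is accepted if it arrives after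
the sample and its endpoints `p e` are unmarked. -/
theorem sum_optimalForest_le {V : Type u} [Fintype V] {E : Type v} [Fintype E] {m k : ℕ}
    {r : E → Rec V} (hP : Proper (Set.range r)) {p : E → V × V}
    (hp : ∀ e, (r e).1 = {(p e).1, (p e).2}) (σ : Fin m ≃ E)
    (b : Fin m → Fin (Fintype.card V) → Bool) :
    ∑ e ∈ optimalForest r, ∑ t ∈ Finset.univ.filter fun t : Fin m => k ≤ t,
        (r e).2.1 * (if σ t = e then
          unmarked {(p e).1, (p e).2} (state k (fun s => r (σ s)) b t) else 0) ≤
      ∑ t ∈ Finset.univ.filter fun t => Accepts k (fun s => r (σ s)) b t, (r (σ t)).2.1 := by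
  rw [Finset.sum_comm, Finset.sum_filter, Finset.sum_filter]
  refine Finset.sum_le_sum fun t _ => ?_
  have hnonneg : (0 : ℝ) ≤ if Accepts k (fun s => r (σ s)) b t then (r (σ t)).2.1 else 0 := by
    split_ifs with h
    · obtain ⟨_, _, _, h, _⟩ := h
      exact h.1.2.1.le
    · exact le_rfl
  by_cases hk : k ≤ t
  swap
  · rw [if_neg hk]
    exact hnonneg
  rw [if_pos hk]
  by_cases ht : σ t ∈ optimalForest r
  swap
  · rw [Finset.sum_eq_zero]
    · exact hnonneg
    · intro e he
      rw [if_neg fun h : σ t = e => ht (by rw [h]; exact he), mul_zero]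
  rw [Finset.sum_eq_single_of_mem _ ht fun e _ hne => by rw [if_neg (Ne.symm hne), mul_zero],
    if_pos rfl]
  by_cases hu : ∀ y ∈ ({(p (σ t)).1, (p (σ t)).2} : Finset V),
      y ∉ state k (fun s => r (σ s)) b t
  swap
  · rw [unmarked, if_neg hu, mul_zero]
    exact hnonneg
  have h1 : (p (σ t)).1 ∉ state k (fun s => r (σ s)) b t := hu _ (by simp)
  have h2 : (p (σ t)).2 ∉ state k (fun s => r (σ s)) b t := hu _ (by simp)
  have hmem : r (σ t) ∈ greedy (seen (fun s => r (σ s)) (t + 1) : Set (Rec V)) := by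
    refine mem_greedy_of_subset ?_ (Finset.mem_filter.mp ht).2
      (Finset.mem_coe.mpr (mem_seen.mpr ⟨t, Nat.lt_succ_self _, rfl⟩))
    intro x hx
    obtain ⟨s, _, rfl⟩ := mem_seen.mp (Finset.mem_coe.mp hx)
    simp
  have hacc : Accepts k (fun s => r (σ s)) b t := by
    refine ⟨hk, ?_⟩
    rcases (isForest_greedy (proper_seen hP σ _)).exists_heads hmem (hp (σ t)) with h | h
    · exact ⟨_, _, h, h1, h2⟩
    · exact ⟨_, _, h, h2, h1⟩
  rw [unmarked, if_pos hu, mul_one, if_pos hacc]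

open scoped Classical in
/-- The expected weight over a random order and random coins, for fixed tie-breaking ranks. -/
theorem factorial_mul_le_sum {V : Type u} [Fintype V] {E : Type v} [Fintype E] {c m : ℕ} {α : ℝ}
    (hm : Fintype.card E = m) (hα : 0 ≤ α) (hN : RatioBound.{u} c m α) {r : E → Rec V}
    (hr : Function.Injective r) (hP : Proper (Set.range r))
    (hpar : ∀ e x y, (r e).1 = {x, y} → ∀ S ⊆ (Finset.univ.erase e).image r,
      (parallel S x y).card ≤ c) :
    (m.factorial : ℝ) * ∑ e ∈ optimalForest r, (r e).2.1 ≤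
      α * ∑ σ : Fin m ≃ E, ∑ b : Fin m → Fin (Fintype.card V) → Bool, tossProb b *
        ∑ t ∈ Finset.univ.filter fun t => Accepts (m / 2) (fun s => r (σ s)) b t,
          (r (σ t)).2.1 := by
  obtain ⟨N, hN, hmean⟩ := hN
  rcases Nat.eq_zero_or_pos m with rfl | hm0
  · have : IsEmpty E := Fintype.card_eq_zero_iff.mp hm
    simp [Finset.eq_empty_of_isEmpty]
  have hpair : ∀ e, ∃ p : V × V, p.1 ≠ p.2 ∧ (r e).1 = {p.1, p.2} := fun e => by
    obtain ⟨a, b, h⟩ := hP.pair (r e) ⟨e, rfl⟩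
    exact ⟨(a, b), h⟩
  choose p hpne hp using hpair
  set k := m / 2
  -- the edge `e` arrives at time `t` and its endpoints are unmarked
  have hterm : ∀ (e : E) (t : Fin m),
      ((Finset.univ.filter fun σ : Fin m ≃ E => σ t = e).card : ℝ) * N t ≤
      ∑ σ : Fin m ≃ E, ∑ b : Fin m → Fin (Fintype.card V) → Bool, tossProb b *
        (if σ t = e then unmarked {(p e).1, (p e).2} (state k (fun s => r (σ s)) b t) else 0) := by
    intro e t
    rw [sum_state_eq_sum_mean hr t t.2.le
      (fun σ H => if σ t = e then unmarked {(p e).1, (p e).2} H else 0)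
      (fun σ π h => by rw [Equiv.trans_apply, h t le_rfl]), ← nsmul_eq_mul, ← Finset.sum_const,
      Finset.sum_filter]
    refine Finset.sum_le_sum fun σ _ => ?_
    split_ifs with h
    · have := hmean V (p e).1 (p e).2 (seen (fun s => r (σ s)) t) (hpne e) (proper_seen hP σ _)
        fun S hS => hpar e _ _ (hp e) S (h ▸ hS.trans (seen_subset r σ t))
      rwa [card_seen hr] at this
    · exact mean_nonneg fun _ => le_rfl
  have hsum : ∑ t ∈ Finset.univ.filter fun t : Fin m => k ≤ t, N t =
      ∑ j ∈ Finset.Ico k m, N j := by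
    rw [Finset.sum_filter, Fin.sum_univ_eq_sum_range (fun j => if k ≤ j then N j else 0) m,
      ← Finset.sum_filter]
    refine Finset.sum_congr ?_ fun _ _ => rfl
    ext j
    simp only [Finset.mem_filter, Finset.mem_range, Finset.mem_Ico]
    omega
  have hfac : ∀ (e : E) (t : Fin m),
      ((Finset.univ.filter fun σ : Fin m ≃ E => σ t = e).card : ℝ) = m.factorial / m := by
    intro e t
    rw [eq_div_iff (by positivity), mul_comm]
    exact_mod_cast card_mul_card_filter_apply_eq hm t e
  have hw : ∀ e ∈ optimalForest r, 0 ≤ (r e).2.1 := fun e he =>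
    (Finset.mem_filter.mp he).2.2.1.le
  calc (m.factorial : ℝ) * ∑ e ∈ optimalForest r, (r e).2.1
      ≤ (m.factorial / m * (α * ∑ j ∈ Finset.Ico k m, N j)) *
          ∑ e ∈ optimalForest r, (r e).2.1 := by
        refine mul_le_mul_of_nonneg_right ?_ (Finset.sum_nonneg hw)
        have hmpos : (0 : ℝ) < m := by exact_mod_cast hm0
        calc (m.factorial : ℝ) = m.factorial / m * m := by field_simp
          _ ≤ _ := by gcongr
    _ = α * ∑ e ∈ optimalForest r, ∑ t ∈ Finset.univ.filter fun t : Fin m => k ≤ t,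
          (r e).2.1 * (((Finset.univ.filter fun σ : Fin m ≃ E => σ t = e).card : ℝ) * N t) := by
        simp only [hfac, ← Finset.mul_sum, ← Finset.sum_mul, hsum]
        ring
    _ ≤ α * ∑ e ∈ optimalForest r, ∑ t ∈ Finset.univ.filter fun t : Fin m => k ≤ t,
          (r e).2.1 * ∑ σ : Fin m ≃ E, ∑ b : Fin m → Fin (Fintype.card V) → Bool, tossProb b *
            (if σ t = e then
              unmarked {(p e).1, (p e).2} (state k (fun s => r (σ s)) b t) else 0) := by
        refine mul_le_mul_of_nonneg_left (Finset.sum_le_sum fun e he =>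
          Finset.sum_le_sum fun t _ => mul_le_mul_of_nonneg_left (hterm e t) (hw e he)) hα
    _ = α * ∑ σ : Fin m ≃ E, ∑ b : Fin m → Fin (Fintype.card V) → Bool, tossProb b *
          ∑ e ∈ optimalForest r, ∑ t ∈ Finset.univ.filter fun t : Fin m => k ≤ t,
            (r e).2.1 * (if σ t = e then
              unmarked {(p e).1, (p e).2} (state k (fun s => r (σ s)) b t) else 0) := by
        congr 1
        simp only [Finset.mul_sum]
        rw [Finset.sum_congr rfl fun e _ => Finset.sum_comm, Finset.sum_comm]
        refine Finset.sum_congr rfl fun σ _ => ?_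
        rw [Finset.sum_congr rfl fun e _ => Finset.sum_comm, Finset.sum_comm]
        refine Finset.sum_congr rfl fun b _ => Finset.sum_congr rfl fun e _ =>
          Finset.sum_congr rfl fun t _ => ?_
        exact mul_left_comm _ _ _
    _ ≤ _ := by
        refine mul_le_mul_of_nonneg_left (Finset.sum_le_sum fun σ _ =>
          Finset.sum_le_sum fun b _ => mul_le_mul_of_nonneg_left
            (sum_optimalForest_le hP hp σ b) (tossProb_nonneg b)) hα

/-! ### The online algorithm -/

/-- The record of an edge, if `rank` breaks ties. -/
def edgeRecord {V : Type u} {E : Type v} {m : ℕ} (G : Graph V E) (w : E → ℝ) (rank : E ≃ Fin m)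
    (e : E) : Rec V :=
  ({x | G.Inc e x}, w e, (rank e : ℕ))

/-- The records of the edges revealed up to time `t`, if the edge of time `s` gets the rank `κ s`;
times after `t` are given a dummy value, which does not matter. -/
noncomputable def revealed {V : Type u} {m : ℕ} (κ : Equiv.Perm (Fin m)) (t : Fin m)
    (h : Set.Iic t → Set V × ℝ) (s : Fin m) : Rec V :=
  if hs : s ≤ t then ((h ⟨s, hs⟩).1, (h ⟨s, hs⟩).2, (κ s : ℕ)) else (∅, 0, 0)

open scoped Classical in
/-- The seed consists of a uniformly random permutation, which breaks ties, and of coins; the sample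
consists of the first `m / 2` edges. -/
noncomputable def algorithm (V : Type u) [Fintype V] (m : ℕ) : OnlineAlgorithm V m where
  Seed := Equiv.Perm (Fin m) × (Fin m → Fin (Fintype.card V) → Bool)
  prob s := tossProb s.2 / m.factorial
  prob_nonneg s := div_nonneg (tossProb_nonneg _) (Nat.cast_nonneg _)
  sum_prob := by
    rw [Fintype.sum_prod_type]
    simp only [← Finset.sum_div, sum_tossProb, Finset.sum_const, Finset.card_univ,
      Fintype.card_perm, Fintype.card_fin, nsmul_eq_mul]
    field_simp
  accept s t h := decide (Accepts (m / 2) (revealed s.1 t h) s.2 t)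

open scoped Classical in
theorem accepted_algorithm {V : Type u} [Fintype V] {E : Type v} {m : ℕ} (G : Graph V E)
    (w : E → ℝ) (σ : Fin m ≃ E) (κ : Equiv.Perm (Fin m))
    (b : Fin m → Fin (Fintype.card V) → Bool) :
    accepted (algorithm V m) G w σ (κ, b) = (Finset.univ.filter fun t =>
      Accepts (m / 2) (fun s => edgeRecord G w (σ.symm.trans κ) (σ s)) b t).map
        σ.toEmbedding := by
  refine congrArg (Finset.map σ.toEmbedding) ?_
  ext t
  simp only [Finset.mem_filter, Finset.mem_univ, true_and]
  change decide (Accepts (m / 2) (revealed κ t (history G w σ t)) b t) = true ↔ _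
  rw [decide_eq_true_iff]
  refine Accepts.congr fun s hs => ?_
  simp [revealed, hs, edgeRecord, history]

theorem isLink_iff_edgeRecord {V : Type u} {E : Type v} {m : ℕ} {G : Graph V E} {w : E → ℝ}
    (hE : G.edgeSet = Set.univ) (rank : E ≃ Fin m) (e : E) (a b : V) :
    G.IsLink e a b ↔ (edgeRecord G w rank e).1 = {a, b} := by
  obtain ⟨x, y, h⟩ := G.exists_isLink_of_mem_edgeSet (hE ▸ Set.mem_univ e)
  have hset : (edgeRecord G w rank e).1 = {x, y} := by
    ext z
    simp only [edgeRecord, Set.mem_ofPred_eq, Set.mem_insert_iff, Set.mem_singleton_iff]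
    constructor
    · intro hz
      rcases hz.eq_or_eq_of_isLink h with h | h
      · exact Or.inl h
      · exact Or.inr h
    · rintro (rfl | rfl)
      · exact h.inc_left
      · exact h.inc_right
  rw [hset]
  constructor
  · intro h'
    rcases h.eq_and_eq_or_eq_and_eq h' with ⟨rfl, rfl⟩ | ⟨rfl, rfl⟩
    · rfl
    · exact Set.pair_comm _ _
  · intro h'
    rcases pair_eq_cases h' with ⟨rfl, rfl⟩ | ⟨rfl, rfl⟩
    · exact h
    · exact h.symm

theorem edgeRecord_injective {V : Type u} {E : Type v} {m : ℕ} (G : Graph V E) (w : E → ℝ)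
    (rank : E ≃ Fin m) : Function.Injective (edgeRecord G w rank) := fun e f h => by
  simp only [edgeRecord, Prod.mk.injEq] at h
  exact rank.injective (Fin.ext h.2.2)

theorem proper_edgeRecord {V : Type u} {E : Type v} {m : ℕ} {G : Graph V E} (w : E → ℝ)
    (hE : G.edgeSet = Set.univ) (hL : G.Loopless) (rank : E ≃ Fin m) :
    Proper (Set.range (edgeRecord G w rank)) where
  pair := by
    rintro _ ⟨e, rfl⟩
    obtain ⟨x, y, h⟩ := G.exists_isLink_of_mem_edgeSet (hE ▸ Set.mem_univ e)
    exact ⟨x, y, h.ne, (isLink_iff_edgeRecord hE rank e x y).mp h⟩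
  rank_injOn := by
    rintro _ ⟨e, rfl⟩ _ ⟨f, rfl⟩ h
    rw [rank.injective (Fin.ext h)]

open scoped Classical in
theorem isCompetitiveOn_algorithm {V : Type u} [Fintype V] {E : Type v} [Fintype E] {c : ℕ} {α : ℝ}
    (hα : 0 ≤ α) (hN : RatioBound.{u} c (Fintype.card E) α) {G : Graph V E} (w : E → ℝ)
    (hE : G.edgeSet = Set.univ) (hL : G.Loopless)
    (hpar : ∀ (rank : E ≃ Fin (Fintype.card E)) (e : E) (x y : V), G.IsLink e x y →
      ∀ S ⊆ (Finset.univ.erase e).image (edgeRecord G w rank), (parallel S x y).card ≤ c) :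
    IsCompetitiveOn α (algorithm V (Fintype.card E)) G w := by
  set m := Fintype.card E with hm
  constructor
  · rintro σ ⟨κ, b⟩ n x e hx he hlink
    rw [accepted_algorithm]
    obtain ⟨i, hi⟩ := exists_not_accepts (k := m / 2) (b := b) (x := x)
      (ρ := fun s => edgeRecord G w (σ.symm.trans κ) (σ s)) (t := fun i => σ.symm (e i))
      (σ.symm.injective.comp he) fun i => by
        rw [Equiv.apply_symm_apply]
        exact (isLink_iff_edgeRecord hE _ _ _ _).mp (hlink i)
    refine ⟨i, fun h => hi ?_⟩
    rw [Finset.mem_map_equiv] at h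
    exact (Finset.mem_filter.mp h).2
  · set W : (E ≃ Fin m) → (Fin m ≃ E) → (Fin m → Fin (Fintype.card V) → Bool) → ℝ :=
      fun rank σ b => ∑ t ∈ Finset.univ.filter fun t =>
        Accepts (m / 2) (fun s => edgeRecord G w rank (σ s)) b t, w (σ t) with hW
    have hrank : ∀ rank : E ≃ Fin m, (m.factorial : ℝ) * opt G w ≤
        α * ∑ σ : Fin m ≃ E, ∑ b, tossProb b * W rank σ b := by
      intro rank
      have h1 := opt_le_sum_optimalForest (edgeRecord_injective G w rank)
        (isLink_iff_edgeRecord hE rank) (fun _ => rfl) (proper_edgeRecord w hE hL rank)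
      have h2 := factorial_mul_le_sum hm.symm hα hN (edgeRecord_injective G w rank)
        (proper_edgeRecord w hE hL rank) fun e x y h =>
          hpar rank e x y ((isLink_iff_edgeRecord hE rank e x y).mpr h)
      exact (mul_le_mul_of_nonneg_left h1 (Nat.cast_nonneg _)).trans h2
    have hcard : Fintype.card (E ≃ Fin m) = m.factorial := by
      rw [Fintype.card_equiv (Fintype.equivFinOfCardEq hm.symm)]
    have hcard' : Fintype.card (Fin m ≃ E) = m.factorial := by
      rw [Fintype.card_equiv (Fintype.equivFinOfCardEq hm.symm).symm, Fintype.card_fin]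
    -- for each order, uniform ranks of the times are uniform ranks of the edges
    have hexp : expectedWeight (algorithm V m) G w =
        (∑ rank : E ≃ Fin m, ∑ σ : Fin m ≃ E, ∑ b, tossProb b * W rank σ b) /
          m.factorial / m.factorial := by
      rw [expectedWeight, hcard']
      congr 1
      rw [Finset.sum_comm (s := Finset.univ (α := E ≃ Fin m)), Finset.sum_div]
      refine Finset.sum_congr rfl fun σ _ => ?_
      rw [← (Equiv.equivCongr σ (Equiv.refl (Fin m))).sum_comp
        (fun rank => ∑ b, tossProb b * W rank σ b), Finset.sum_div]
      change ∑ s : Equiv.Perm (Fin m) × (Fin m → Fin (Fintype.card V) → Bool),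
        tossProb s.2 / m.factorial * ∑ e ∈ accepted (algorithm V m) G w σ s, w e = _
      rw [Fintype.sum_prod_type]
      refine Finset.sum_congr rfl fun κ _ => ?_
      rw [Finset.sum_div]
      refine Finset.sum_congr rfl fun b _ => ?_
      rw [accepted_algorithm, Finset.sum_map]
      change tossProb b / m.factorial * W (σ.symm.trans κ) σ b = _
      have : Equiv.equivCongr σ (Equiv.refl (Fin m)) κ = σ.symm.trans κ := by
        ext; simp [Equiv.equivCongr]
      rw [this]
      ring
    have hsum := Finset.sum_le_sum (s := Finset.univ (α := E ≃ Fin m)) fun rank _ => hrank rank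
    rw [Finset.sum_const, Finset.card_univ, hcard, nsmul_eq_mul, ← Finset.mul_sum] at hsum
    have hpos : (0 : ℝ) < m.factorial := by exact_mod_cast m.factorial_pos
    rw [hexp, div_div, ← mul_div_assoc, le_div_iff₀ (by positivity)]
    linarith

theorem parallel_eq_empty {V : Type u} {E : Type v} [Fintype E] [DecidableEq E]
    [DecidableEq (Rec V)] {m : ℕ} {G : Graph V E} {w : E → ℝ} (hE : G.edgeSet = Set.univ)
    (hG : G.Simple) (rank : E ≃ Fin m) {e : E} {x y : V} (h : G.IsLink e x y)
    {S : Finset (Rec V)} (hS : S ⊆ (Finset.univ.erase e).image (edgeRecord G w rank)) :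
    parallel S x y = ∅ := by
  classical
  refine Finset.filter_false_of_mem fun g hg hgr => ?_
  obtain ⟨f, hf, rfl⟩ := Finset.mem_image.mp (hS hg)
  exact Finset.ne_of_mem_erase hf
    (hG.eq_of_isLink ((isLink_iff_edgeRecord hE rank f x y).mpr hgr.2) h)

end GraphicSecretary

theorem theorem1 :
    (∃ A : (V : Type u) → [Fintype V] → (m : ℕ) → GraphicSecretary.OnlineAlgorithm V m,
      ∀ (V : Type u) [Fintype V] (E : Type v) [Fintype E] (G : Graph V E) (w : E → ℝ),
        G.vertexSet = Set.univ → G.edgeSet = Set.univ → G.Loopless →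
          GraphicSecretary.IsCompetitiveOn 3.95 (A V (Fintype.card E)) G w) ∧
    (∃ A : (V : Type u) → [Fintype V] → (m : ℕ) → GraphicSecretary.OnlineAlgorithm V m,
      ∀ (V : Type u) [Fintype V] (E : Type v) [Fintype E] (G : Graph V E) (w : E → ℝ),
        G.vertexSet = Set.univ → G.edgeSet = Set.univ → G.Simple →
          GraphicSecretary.IsCompetitiveOn 3.77 (A V (Fintype.card E)) G w) := by
  classical
  refine ⟨⟨fun V _ m => GraphicSecretary.algorithm V m, fun V _ E _ G w _ hE hL => ?_⟩,
    ⟨fun V _ m => GraphicSecretary.algorithm V m, fun V _ E _ G w _ hE hG => ?_⟩⟩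
  · refine GraphicSecretary.isCompetitiveOn_algorithm (by norm_num)
      (GraphicSecretary.ratioBound_one _) w hE hL
      fun rank e x y _ S hS => GraphicSecretary.card_parallel_le_one
        ((GraphicSecretary.proper_edgeRecord w hE hL rank).mono ?_) x y
    refine (Finset.coe_subset.mpr hS).trans ?_
    rw [Finset.coe_image]
    exact Set.image_subset_range _ _
  · refine GraphicSecretary.isCompetitiveOn_algorithm (by norm_num)
      (GraphicSecretary.ratioBound_zero _) w hE hG.toLoopless
      fun rank e x y h S hS => ?_
    rw [GraphicSecretary.parallel_eq_empty hE hG rank h hS, Finset.card_empty]
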